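/- For $n\ge 1$ and $r\ge 0$ let $G=G(n,r)$ be the random geometric graph: its nodes are $n$ points chosen independently and uniformly at random in the square $S=[0,1]^2$, and two distinct nodes are adjacent if and only if their Euclidean distance is at most $r$. Let $\gamma(G)$ be the domination number of $G$, i.e. the least size of a set $D$ of nodes such that every node outside $D$ has a neighbour in $D$. For real $x$ let $N(x)$ be the least number of closed discs of radius $x$, with centres anywhere in the plane, that cover $S$ (with $N(x)=\infty$ for $x\le 0$). An event holds asymptotically almost surely (a.a.s.) if its probability tends to $1$ as $n\to\infty$. Let $r=r(n)\ge 0$, and let $\omega=\omega(n)$ be any function tending to infinity as $n\to\infty$. The inequalities on $r$ below are required for all sufficiently large $n$. (a) If $r=\Theta(1)$, then a.a.s. $$\Omega(1)=N\bigl(r+\sqrt{\omega\log n/n}\bigr)\le\gamma(G)\le N\bigl(r-\omega/\sqrt n\bigr).$$ (b) Let $C=2\pi\sqrt3/9$. If $\omega\sqrt{\log n/n}\le r=o(1)$, then a.a.s. $\gamma(G)=(C/\pi+o(1))\,r^{-2}$; that is, for every fixed $\varepsilon>0$, a.a.s. $|\gamma(G)-(C/\pi)r^{-2}|\le\varepsilon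 r^{-2}$. (c) If $1/\sqrt n\le r<\omega\sqrt{\log n/n}$ and $r=O(1)$, then a.a.s. $\gamma(G)=\Theta(r^{-2})$; that is, there are constants $c_1,c_2>0$ such that a.a.s. $c_1r^{-2}\le\gamma(G)\le c_2r^{-2}$. (d) If $r<1/\sqrt n$, then a.a.s. $\gamma(G)=\Theta(n)$; that is, there are constants $c_1,c_2>0$ such that a.a.s. $c_1n\le\gamma(G)\le c_2n$. -/

import Mathlib

open Filter Topology MeasureTheory
open scoped ENNReal NNReal

namespace RandomGeometricGraph

/-- The Euclidean plane. -/
abbrev Plane : Type := EuclideanSpace ℝ (Fin 2)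

/-- The closed unit square `[0,1]²`. -/
def unitSquare : Set Plane := {p | ∀ i, p i ∈ Set.Icc (0 : ℝ) 1}

/-- The uniform distribution on the unit square (which has area one). -/
noncomputable def uniformSquare : Measure Plane := volume.restrict unitSquare

instance : IsProbabilityMeasure uniformSquare := by
  constructor
  rw [uniformSquare, Measure.restrict_apply_univ]
  have h : unitSquare = (WithLp.ofLp : Plane → Fin 2 → ℝ) ⁻¹'
      (Set.pi Set.univ fun _ => Set.Icc (0 : ℝ) 1) := by
    ext p
    simp only [unitSquare, Set.mem_ofPred_eq, Set.mem_preimage, Set.mem_univ_pi]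
  rw [h, (PiLp.volume_preserving_ofLp (Fin 2)).measure_preimage
    (MeasurableSet.univ_pi fun _ => measurableSet_Icc).nullMeasurableSet, volume_pi_pi]
  simp

/-- The joint law of `n` independent uniform points of the unit square. -/
noncomputable def pointsLaw (n : ℕ) : Measure (Fin n → Plane) :=
  Measure.pi fun _ => uniformSquare

/-- The events `E n` (about `n` independent uniform points) hold asymptotically almost surely. -/
def AAS (E : ∀ n : ℕ, Set (Fin n → Plane)) : Prop :=
  Tendsto (fun n => pointsLaw n (E n)) atTop (𝓝 1)

/-- The geometric graph on the points `X 0, …, X (n - 1)`: two distinct nodes are adjacent iff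
their Euclidean distance is at most `r`. -/
def geometricGraph {n : ℕ} (X : Fin n → Plane) (r : ℝ) : SimpleGraph (Fin n) where
  Adj i j := i ≠ j ∧ dist (X i) (X j) ≤ r
  symm := ⟨fun _ _ h => ⟨h.1.symm, (dist_comm _ _).trans_le h.2⟩⟩
  loopless := ⟨fun _ h => h.1 rfl⟩

/-- `S` is a dominating set: every node outside `S` is adjacent to a node of `S`. -/
def IsDominating {V : Type*} (G : SimpleGraph V) (S : Finset V) : Prop :=
  ∀ v, v ∉ S → ∃ u ∈ S, G.Adj v u

/-- The domination number of a finite graph: the least cardinality of a dominating set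
(the set of all nodes is dominating, so the infimum is over a nonempty set). -/
noncomputable def dominationNumber {V : Type*} [Fintype V] (G : SimpleGraph V) : ℕ :=
  sInf {k | ∃ S : Finset V, IsDominating G S ∧ S.card = k}

/-- `N(x)`: the least number of closed discs of radius `x`, centred anywhere in the plane, that
cover the unit square. It is `⊤` for `x ≤ 0`, where no finite cover exists. -/
noncomputable def squareCoveringNumber (x : ℝ) : ℕ∞ :=
  Metric.externalCoveringNumber x.toNNReal unitSquare

/-- The constant `C = 2π√3/9`. -/
noncomputable def coveringConstant : ℝ := 2 * Real.pi * √3 / 9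

end RandomGeometricGraph

open RandomGeometricGraph

/-!
The domination number is compared with covering numbers of the square. If every point of the
square has a node within distance `δ`, then the discs of radius `r + δ` about a dominating set
cover the square, and conversely a covering by discs of radius `r - δ` becomes a dominating set
when each centre is replaced by a nearby node. So `N(r + δ) ≤ γ ≤ N(r - δ)`
(`squareCoveringNumber_le_dominationNumber`, `dominationNumber_le_squareCoveringNumber`). A union
bound over a grid of cells shows that a.a.s. `δ = 4 √(log n / n)` works (`exists_bad_not_dense`).
When `r` is bounded away from zero, an optimal covering has boundedly many discs, and for the upper
bound it is enough to find nodes near their centres, for which any `δ` with `δ √n → ∞` does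
(`exists_bad_not_near`).

When `r → 0` and `δ = o(r)`, it remains to determine the density of the thinnest coverings of the
square by discs. The upper bound is the hexagonal covering (`exists_hexagonal_cover`). The lower
bound, Kershner's theorem (`covering_lower_bound`), is proved with Delaunay triangles. After a
small perturbation the `N` centres are in general position. Every point away from the boundary lies
in a triangle of centres whose circumscribed circle contains no centre in its interior
(`exists_isDelaunay_mem_convexHull`); as the discs cover, this circle has radius at most `R`, and
the area of the triangle is at most `(3√3/4) R²`. There are at most `2N` such triangles, because a
triangle is determined by its middle vertex in the order of first coordinates and by the side of
the opposite edge on which this vertex lies (`IsDelaunay.eq_of_middle`,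
`card_delaunay_triangles_le`). Hence `N (3√3/2) R²` is at least the area of the square up to `O(R)`.

For smaller `r` only orders of magnitude matter. In a grid with at most `n` cells more than a
quarter of the cells are occupied, with probability at least `1 - 2⁻ⁿ`
(`pointsLaw_few_cells_le`). A node dominates nodes in at most nine cells of width `r` or more,
which gives the lower bounds; one node from each occupied cell of diagonal at most `r` gives the
upper bound.
-/

namespace RandomGeometricGraph

/-! ### The plane and the grid of closed cells -/

lemma dist_sq_eq (p q : Plane) : dist p q ^ 2 = (p 0 - q 0) ^ 2 + (p 1 - q 1) ^ 2 := by
  rw [EuclideanSpace.dist_eq, Real.sq_sqrt (by positivity)]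
  simp [Fin.sum_univ_two, Real.dist_eq, sq_abs]

lemma dist_le_iff_sq {p q : Plane} {R : ℝ} (hR : 0 ≤ R) :
    dist p q ≤ R ↔ (p 0 - q 0) ^ 2 + (p 1 - q 1) ^ 2 ≤ R ^ 2 := by
  rw [← dist_sq_eq, sq_le_sq₀ dist_nonneg hR]

lemma abs_coord_sub_le (p q : Plane) (i : Fin 2) : |p i - q i| ≤ dist p q := by
  rw [dist_eq_norm]
  exact PiLp.norm_apply_le (p - q) i

lemma volume_box (a b : Fin 2 → ℝ) :
    volume {p : Plane | ∀ i, p i ∈ Set.Icc (a i) (b i)} = ∏ i, ENNReal.ofReal (b i - a i) := by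
  have h : {p : Plane | ∀ i, p i ∈ Set.Icc (a i) (b i)} = (WithLp.ofLp : Plane → Fin 2 → ℝ) ⁻¹'
      (Set.pi Set.univ fun i => Set.Icc (a i) (b i)) := by
    ext p
    simp only [Set.mem_ofPred_eq, Set.mem_preimage, Set.mem_univ_pi]
  rw [h, (PiLp.volume_preserving_ofLp (Fin 2)).measure_preimage
    (MeasurableSet.univ_pi fun _ => measurableSet_Icc).nullMeasurableSet, volume_pi_pi]
  simp

lemma measurableSet_box (a b : Fin 2 → ℝ) :
    MeasurableSet {p : Plane | ∀ i, p i ∈ Set.Icc (a i) (b i)} := by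
  have h : {p : Plane | ∀ i, p i ∈ Set.Icc (a i) (b i)} =
      ⋂ i, (fun p : Plane => p i) ⁻¹' Set.Icc (a i) (b i) := by
    ext p; simp
  rw [h]
  exact MeasurableSet.iInter fun i => (by fun_prop : Measurable fun p : Plane => p i)
    measurableSet_Icc

lemma measurableSet_unitSquare : MeasurableSet unitSquare := measurableSet_box _ _

/-- The closed cell with index `q` of the subdivision of the unit square into `k × k` congruent
squares. Neighbouring cells overlap in their common side. -/
def gridCell (k : ℕ) (q : Fin 2 → Fin k) : Set Plane :=
  {p | ∀ i, p i ∈ Set.Icc ((q i : ℝ) / k) (((q i : ℝ) + 1) / k)}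

lemma measurableSet_gridCell (k : ℕ) (q : Fin 2 → Fin k) : MeasurableSet (gridCell k q) :=
  measurableSet_box _ _

lemma gridCell_subset_unitSquare (k : ℕ) (q : Fin 2 → Fin k) : gridCell k q ⊆ unitSquare := by
  intro p hp i
  have hk : (0 : ℝ) < k := by exact_mod_cast (q i).pos
  refine ⟨le_trans (by positivity) (hp i).1, (hp i).2.trans ?_⟩
  rw [div_le_one hk]
  exact_mod_cast (q i).isLt

lemma uniformSquare_gridCell (k : ℕ) (q : Fin 2 → Fin k) :
    uniformSquare (gridCell k q) = ENNReal.ofReal (1 / (k : ℝ) ^ 2) := by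
  have hk : (0 : ℝ) < k := by exact_mod_cast (q 0).pos
  rw [uniformSquare, Measure.restrict_apply (measurableSet_gridCell k q),
    Set.inter_eq_left.2 (gridCell_subset_unitSquare k q), gridCell, volume_box, Fin.prod_univ_two,
    ← ENNReal.ofReal_mul]
  · congr 1
    field_simp
    ring
  · rw [← sub_div]; simp

/-- The index of a cell that contains the point `p` of the unit square. On the common side of two
cells the one with the larger index is taken, if there is one. -/
noncomputable def cellIndex (k : ℕ) [NeZero k] (p : Plane) : Fin 2 → Fin k :=
  fun i => ⟨min ⌊k * p i⌋₊ (k - 1), by have := NeZero.pos k; omega⟩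

lemma mem_gridCell_cellIndex {k : ℕ} [NeZero k] {p : Plane} (hp : p ∈ unitSquare) :
    p ∈ gridCell k (cellIndex k p) := by
  intro i
  have hk' := NeZero.pos k
  have hk : (0 : ℝ) < k := by exact_mod_cast hk'
  obtain ⟨h0, h1⟩ := hp i
  have hfl : (⌊k * p i⌋₊ : ℝ) ≤ k * p i := Nat.floor_le (by positivity)
  have hlt : k * p i < ⌊k * p i⌋₊ + 1 := Nat.lt_floor_add_one _
  rw [Set.mem_Icc, div_le_iff₀ hk, le_div_iff₀ hk]
  simp only [cellIndex]
  have hk1 : ((k - 1 : ℕ) : ℝ) = k - 1 := by rw [Nat.cast_sub hk']; simp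
  refine ⟨?_, ?_⟩
  · rw [Nat.cast_min]
    exact (min_le_left _ _).trans (by linarith)
  · rw [Nat.cast_min, hk1]
    rcases min_choice (⌊k * p i⌋₊ : ℝ) ((k : ℝ) - 1) with h | h <;> rw [h] <;> nlinarith

/-- Points at distance at most the side of a cell lie in the same cell or in adjacent cells. -/
lemma cellIndex_le_succ {k : ℕ} [NeZero k] {p q : Plane} (hq : q ∈ unitSquare)
    (h : dist p q ≤ 1 / k) (i : Fin 2) : (cellIndex k p i : ℕ) ≤ cellIndex k q i + 1 := by
  have hk' := NeZero.pos k
  have hk : (0 : ℝ) < k := by exact_mod_cast hk'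
  have h1 : |p i - q i| ≤ 1 / k := (abs_coord_sub_le p q i).trans h
  have h2 : k * p i ≤ k * q i + 1 := by
    have := (abs_le.1 h1).2
    rw [le_div_iff₀ hk] at this
    linarith
  have h3 : ⌊k * p i⌋₊ ≤ ⌊k * q i⌋₊ + 1 := by
    rw [← Nat.floor_add_one (mul_nonneg hk.le (hq i).1)]
    exact Nat.floor_le_floor h2
  simp only [cellIndex]
  omega

lemma dist_le_of_mem_gridCell {k : ℕ} {c : Fin 2 → Fin k} {p q : Plane}
    (hp : p ∈ gridCell k c) (hq : q ∈ gridCell k c) : dist p q ≤ √2 / k := by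
  have hk : (0 : ℝ) < k := by exact_mod_cast (c 0).pos
  rw [dist_le_iff_sq (by positivity), div_pow, Real.sq_sqrt (by norm_num)]
  have key : ∀ i, (p i - q i) ^ 2 ≤ 1 / (k : ℝ) ^ 2 := by
    intro i
    have h1 := hp i
    have h2 := hq i
    rw [← one_div_pow, sq_le_sq, abs_of_pos (show (0 : ℝ) < 1 / k by positivity), abs_le]
    have : ((c i : ℝ) + 1) / k = (c i : ℝ) / k + 1 / k := by ring
    constructor <;> linarith [h1.1, h1.2, h2.1, h2.2]
  have := key 0
  have := key 1
  calc _ ≤ 1 / (k : ℝ) ^ 2 + 1 / (k : ℝ) ^ 2 := by linarith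
    _ = _ := by ring

/-! ### Probabilities of events about cells -/

instance (n : ℕ) : IsProbabilityMeasure (pointsLaw n) := by
  unfold pointsLaw; infer_instance

/-- An event that, up to a negligible exceptional event, is implied by all nodes lying in the
square holds a.a.s. No measurability is needed, since outer measures are subadditive. -/
lemma AAS.of_bad {E : ∀ n : ℕ, Set (Fin n → Plane)} {b : ℕ → ℝ≥0∞} (hb : Tendsto b atTop (𝓝 0))
    (h : ∀ᶠ n : ℕ in atTop, ∃ B : Set (Fin n → Plane), pointsLaw n B ≤ b n ∧
      ∀ X : Fin n → Plane, (∀ i, X i ∈ unitSquare) → X ∉ B → X ∈ E n) :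
    AAS E := by
  have hout : ∀ n, pointsLaw n {X | ∀ i, X i ∈ unitSquare}ᶜ = 0 := by
    intro n
    have hn : ∀ i : Fin n, pointsLaw n ((fun X : Fin n → Plane => X i) ⁻¹' unitSquareᶜ) = 0 := by
      intro i
      rw [pointsLaw, (measurePreserving_eval (fun _ : Fin n => uniformSquare) i).measure_preimage
        measurableSet_unitSquare.compl.nullMeasurableSet, uniformSquare,
        Measure.restrict_apply measurableSet_unitSquare.compl]
      simp
    refine measure_mono_null ?_ (measure_iUnion_null hn)
    intro X hX
    simpa using hX
  refine tendsto_of_tendsto_of_tendsto_of_le_of_le' (g := fun n => 1 - b n)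
    (h := fun _ => 1) ?_ tendsto_const_nhds ?_ (Eventually.of_forall fun n => prob_le_one)
  · simpa using ENNReal.Tendsto.sub tendsto_const_nhds hb (by simp)
  · filter_upwards [h] with n ⟨B, hB, hn⟩
    rw [tsub_le_iff_right]
    calc (1 : ℝ≥0∞) = pointsLaw n Set.univ := measure_univ.symm
      _ ≤ pointsLaw n (E n ∪ (B ∪ {X | ∀ i, X i ∈ unitSquare}ᶜ)) := by
          refine measure_mono fun X _ => ?_
          by_cases h1 : ∀ i, X i ∈ unitSquare
          · by_cases h2 : X ∈ B
            · exact Or.inr (Or.inl h2)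
            · exact Or.inl (hn X h1 h2)
          · exact Or.inr (Or.inr h1)
      _ ≤ pointsLaw n (E n) + (pointsLaw n B + 0) := by
          rw [← hout n]
          exact (measure_union_le _ _).trans (by gcongr; exact measure_union_le _ _)
      _ ≤ _ := by rw [add_zero]; gcongr

lemma pointsLaw_forall_mem (n : ℕ) (s : Set Plane) :
    pointsLaw n {X | ∀ i, X i ∈ s} = uniformSquare s ^ n := by
  have : {X : Fin n → Plane | ∀ i, X i ∈ s} = Set.pi Set.univ fun _ => s := by
    ext X; simp
  rw [this, pointsLaw, Measure.pi_pi]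
  simp

lemma pointsLaw_exists_empty_cell_le (n k : ℕ) (A : Finset (Fin 2 → Fin k)) :
    pointsLaw n {X | ∃ q ∈ A, ∀ i, X i ∉ gridCell k q} ≤
      ENNReal.ofReal (A.card * Real.exp (-(n / (k : ℝ) ^ 2))) := by
  have hU : {X : Fin n → Plane | ∃ q ∈ A, ∀ i, X i ∉ gridCell k q} =
      ⋃ q ∈ A, {X | ∀ i, X i ∈ (gridCell k q)ᶜ} := by
    ext X; simp
  rw [hU]
  refine (measure_biUnion_finset_le A _).trans ?_
  rw [ENNReal.ofReal_mul (by positivity), ENNReal.ofReal_natCast, ← nsmul_eq_mul]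
  refine Finset.sum_le_card_nsmul _ _ _ fun q _ => ?_
  have hk : (0 : ℝ) < k := by exact_mod_cast (q 0).pos
  have hk1 : (1 : ℝ) ≤ k := by exact_mod_cast (q 0).pos
  rw [pointsLaw_forall_mem, prob_compl_eq_one_sub (measurableSet_gridCell k q),
    uniformSquare_gridCell, ← ENNReal.ofReal_one, ← ENNReal.ofReal_sub _ (by positivity),
    ← ENNReal.ofReal_pow (by
      rw [sub_nonneg, div_le_one (by positivity)]; exact one_le_pow₀ hk1)]
  refine ENNReal.ofReal_le_ofReal ?_
  have h0 : (0 : ℝ) ≤ 1 - 1 / (k : ℝ) ^ 2 := by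
    rw [sub_nonneg, div_le_one (by positivity)]; exact one_le_pow₀ hk1
  calc (1 - 1 / (k : ℝ) ^ 2) ^ n ≤ Real.exp (-(1 / (k : ℝ) ^ 2)) ^ n := by
        gcongr
        linarith [Real.add_one_le_exp (-(1 / (k : ℝ) ^ 2))]
    _ = _ := by rw [← Real.exp_nat_mul]; congr 1; ring

/-- A quarter of the cells of a grid with at most `n` cells contain all the nodes only with
exponentially small probability: there are at most `2 ^ n` choices of the quarter, and each of them
captures all the nodes with probability at most `4⁻ⁿ`. -/
lemma pointsLaw_few_cells_le {n k : ℕ} (hk : 1 ≤ k) (hkn : k ^ 2 ≤ n) :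
    pointsLaw n {X | ∃ A : Finset (Fin 2 → Fin k), 4 * A.card ≤ k ^ 2 ∧
      ∀ i, ∃ q ∈ A, X i ∈ gridCell k q} ≤ ENNReal.ofReal ((1 / 2) ^ n) := by
  classical
  have hk0 : (0 : ℝ) < k := by exact_mod_cast hk
  set F : Finset (Finset (Fin 2 → Fin k)) := Finset.univ.filter fun A => 4 * A.card ≤ k ^ 2
  have hU : {X : Fin n → Plane | ∃ A : Finset (Fin 2 → Fin k), 4 * A.card ≤ k ^ 2 ∧
      ∀ i, ∃ q ∈ A, X i ∈ gridCell k q} =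
      ⋃ A ∈ F, {X | ∀ i, X i ∈ ⋃ q ∈ A, gridCell k q} := by
    ext X; simp [F]
  rw [hU]
  refine (measure_biUnion_finset_le F _).trans ?_
  have hF : F.card ≤ 2 ^ n := by
    refine (Finset.card_filter_le _ _).trans ?_
    rw [Finset.card_univ, Fintype.card_finset, Fintype.card_fun, Fintype.card_fin,
      Fintype.card_fin]
    exact Nat.pow_le_pow_right (by norm_num) hkn
  have hsum : ∀ A ∈ F, pointsLaw n {X | ∀ i, X i ∈ ⋃ q ∈ A, gridCell k q} ≤
      ENNReal.ofReal ((1 / 4) ^ n) := by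
    intro A hA
    rw [pointsLaw_forall_mem, ENNReal.ofReal_pow (by norm_num)]
    gcongr
    refine (measure_biUnion_finset_le A _).trans ?_
    simp only [uniformSquare_gridCell, Finset.sum_const, nsmul_eq_mul]
    rw [← ENNReal.ofReal_natCast, ← ENNReal.ofReal_mul (by positivity)]
    refine ENNReal.ofReal_le_ofReal ?_
    have hA' : (4 * A.card : ℝ) ≤ (k : ℝ) ^ 2 := by
      exact_mod_cast (Finset.mem_filter.1 hA).2
    rw [mul_one_div, div_le_div_iff₀ (by positivity) (by norm_num)]
    linarith
  refine (Finset.sum_le_card_nsmul _ _ _ hsum).trans ?_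
  rw [nsmul_eq_mul, ← ENNReal.ofReal_natCast, ← ENNReal.ofReal_mul (by positivity)]
  refine ENNReal.ofReal_le_ofReal ?_
  calc (F.card : ℝ) * (1 / 4) ^ n ≤ 2 ^ n * (1 / 4) ^ n := by
        gcongr; exact_mod_cast hF
    _ = _ := by rw [← mul_pow]; norm_num

/-! ### Dominating sets and coverings of the square -/

lemma exists_isDominating_card_eq {V : Type*} [Fintype V] (G : SimpleGraph V) :
    ∃ D : Finset V, IsDominating G D ∧ D.card = dominationNumber G :=
  Nat.sInf_mem (s := {k | ∃ S : Finset V, IsDominating G S ∧ S.card = k})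
    ⟨_, Finset.univ, fun v hv => absurd (Finset.mem_univ v) hv, rfl⟩

lemma dominationNumber_le {V : Type*} [Fintype V] {G : SimpleGraph V} {D : Finset V}
    (hD : IsDominating G D) : dominationNumber G ≤ D.card :=
  Nat.sInf_le ⟨D, hD, rfl⟩

lemma dominationNumber_le_card {n : ℕ} (G : SimpleGraph (Fin n)) : dominationNumber G ≤ n := by
  have : IsDominating G Finset.univ := fun v hv => absurd (Finset.mem_univ v) hv
  simpa using dominationNumber_le this

lemma isDominating_geometricGraph {n : ℕ} {X : Fin n → Plane} {r : ℝ} {D : Finset (Fin n)}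
    (h : ∀ i, ∃ u ∈ D, dist (X i) (X u) ≤ r) : IsDominating (geometricGraph X r) D := by
  intro i hi
  obtain ⟨u, hu, hd⟩ := h i
  exact ⟨u, hu, fun e => hi (e ▸ hu), hd⟩

lemma exists_dist_le_of_isDominating {n : ℕ} {X : Fin n → Plane} {r : ℝ} (hr : 0 ≤ r)
    {D : Finset (Fin n)} (hD : IsDominating (geometricGraph X r) D) (i : Fin n) :
    ∃ u ∈ D, dist (X i) (X u) ≤ r := by
  by_cases hi : i ∈ D
  · exact ⟨i, hi, by simpa using hr⟩
  · obtain ⟨u, hu, h⟩ := hD i hi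
    exact ⟨u, hu, h.2⟩

lemma squareCoveringNumber_le_card {x : ℝ} {C : Finset Plane}
    (hC : ∀ y ∈ unitSquare, ∃ c ∈ C, dist y c ≤ x) : squareCoveringNumber x ≤ C.card := by
  have h : Metric.IsCover x.toNNReal unitSquare (C : Set Plane) := by
    intro y hy
    obtain ⟨c, hc, hd⟩ := hC y hy
    refine ⟨c, hc, ?_⟩
    change edist y c ≤ ENNReal.ofReal x
    rw [edist_dist]
    exact ENNReal.ofReal_le_ofReal hd
  have := h.externalCoveringNumber_le_encard
  rwa [Set.encard_coe_eq_coe_finsetCard] at this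

lemma exists_cover_card_eq {x : ℝ} (hx : 0 ≤ x) (hN : squareCoveringNumber x ≠ ⊤) :
    ∃ C : Finset Plane, (∀ y ∈ unitSquare, ∃ c ∈ C, dist y c ≤ x) ∧
      (C.card : ℕ∞) = squareCoveringNumber x := by
  have hne : Nonempty {C : Set Plane // Metric.IsCover x.toNNReal unitSquare C} :=
    ⟨⟨_, Metric.IsCover.rfl⟩⟩
  obtain ⟨⟨C, hC⟩, hCe⟩ := ENat.exists_eq_iInf
    fun C : {C : Set Plane // Metric.IsCover x.toNNReal unitSquare C} => (C : Set Plane).encard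
  have he : C.encard = squareCoveringNumber x := by
    rw [squareCoveringNumber, Metric.externalCoveringNumber, iInf_subtype']
    exact hCe
  have hfin : C.Finite := Set.encard_ne_top_iff.1 (he ▸ hN)
  refine ⟨hfin.toFinset, fun y hy => ?_, ?_⟩
  · obtain ⟨c, hc, hd⟩ := hC hy
    refine ⟨c, by simpa using hc, ?_⟩
    change edist y c ≤ ENNReal.ofReal x at hd
    rwa [edist_dist, ENNReal.ofReal_le_ofReal_iff hx] at hd
  · rw [← he, hfin.encard_eq_coe_toFinset_card]

lemma squareCoveringNumber_antitone : Antitone squareCoveringNumber := fun _ _ h =>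
  Metric.externalCoveringNumber_anti (Real.toNNReal_le_toNNReal h)

lemma one_le_squareCoveringNumber (x : ℝ) : 1 ≤ squareCoveringNumber x := by
  rw [Order.one_le_iff_pos]
  exact Metric.externalCoveringNumber_pos_iff.2 ⟨0, fun i => by simp⟩

/-- If the nodes are `δ`-dense in the square, the discs of radius `r + δ` about the nodes of a
dominating set cover the square. -/
lemma squareCoveringNumber_le_dominationNumber {n : ℕ} {X : Fin n → Plane} {r δ : ℝ} (hr : 0 ≤ r)
    (hX : ∀ y ∈ unitSquare, ∃ i, dist y (X i) ≤ δ) :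
    squareCoveringNumber (r + δ) ≤ (dominationNumber (geometricGraph X r) : ℕ∞) := by
  classical
  obtain ⟨D, hD, hcard⟩ := exists_isDominating_card_eq (geometricGraph X r)
  rw [← hcard]
  refine (squareCoveringNumber_le_card (C := D.image X) fun y hy => ?_).trans ?_
  · obtain ⟨i, hi⟩ := hX y hy
    obtain ⟨u, hu, hd⟩ := exists_dist_le_of_isDominating hr hD i
    refine ⟨X u, Finset.mem_image_of_mem X hu, ?_⟩
    linarith [dist_triangle y (X i) (X u)]
  · exact_mod_cast Finset.card_image_le

/-- The nearest point of the unit square, computed coordinatewise. -/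
noncomputable def clampSquare (p : Plane) : Plane := WithLp.toLp 2 fun i => max 0 (min (p i) 1)

lemma clampSquare_mem (p : Plane) : clampSquare p ∈ unitSquare := by
  intro i
  simp [clampSquare]

lemma dist_clampSquare_le {y : Plane} (hy : y ∈ unitSquare) (p : Plane) :
    dist y (clampSquare p) ≤ dist y p := by
  rw [dist_le_iff_sq dist_nonneg, dist_sq_eq]
  have key : ∀ i, (y i - clampSquare p i) ^ 2 ≤ (y i - p i) ^ 2 := by
    intro i
    obtain ⟨h0, h1⟩ := hy i
    simp only [clampSquare]
    rcases le_total (p i) 1 with h | h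
    · rw [min_eq_left h]
      rcases le_total 0 (p i) with h' | h'
      · rw [max_eq_right h']
      · rw [max_eq_left h']; nlinarith
    · rw [min_eq_right h, max_eq_right zero_le_one]; nlinarith
  exact add_le_add (key 0) (key 1)

/-- From a cover by discs of radius `x` a dominating set arises by taking a node close to each
centre, after the centres have been moved into the square. -/
lemma dominationNumber_le_card_cover {n : ℕ} {X : Fin n → Plane} {r x δ : ℝ}
    (hX : ∀ i, X i ∈ unitSquare) (hxr : x + δ ≤ r) {C : Finset Plane}
    (hC : ∀ y ∈ unitSquare, ∃ c ∈ C, dist y c ≤ x)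
    (hnear : ∀ c ∈ C, ∃ i, dist (clampSquare c) (X i) ≤ δ) :
    dominationNumber (geometricGraph X r) ≤ C.card := by
  classical
  rcases isEmpty_or_nonempty (Fin n) with hn | hn
  · have : n = 0 := (Fintype.card_fin n).symm.trans (Fintype.card_eq_zero_iff.2 hn)
    exact (dominationNumber_le_card _).trans (by omega)
  choose! f hf using hnear
  refine (dominationNumber_le (isDominating_geometricGraph (D := C.image f) fun i => ?_)).trans
    Finset.card_image_le
  obtain ⟨c, hc, hd⟩ := hC (X i) (hX i)
  refine ⟨f c, Finset.mem_image_of_mem f hc, ?_⟩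
  linarith [dist_triangle (X i) (clampSquare c) (X (f c)), dist_clampSquare_le (hX i) c, hf c hc]

lemma dominationNumber_le_squareCoveringNumber {n : ℕ} {X : Fin n → Plane} {r δ : ℝ}
    (hX : ∀ i, X i ∈ unitSquare) (hδ : δ ≤ r)
    (hdense : ∀ y ∈ unitSquare, ∃ i, dist y (X i) ≤ δ) :
    (dominationNumber (geometricGraph X r) : ℕ∞) ≤ squareCoveringNumber (r - δ) := by
  by_cases hN : squareCoveringNumber (r - δ) = ⊤
  · rw [hN]; exact le_top
  obtain ⟨C, hC, hcard⟩ := exists_cover_card_eq (sub_nonneg.2 hδ) hN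
  rw [← hcard]
  exact_mod_cast dominationNumber_le_card_cover hX (by linarith) hC
    fun c _ => hdense _ (clampSquare_mem c)

/-- If the diagonal of a cell is at most `r`, one node from each occupied cell suffices. -/
lemma dominationNumber_le_sq {n k : ℕ} [NeZero k] {X : Fin n → Plane} {r : ℝ}
    (hX : ∀ i, X i ∈ unitSquare) (hk : √2 / k ≤ r) :
    dominationNumber (geometricGraph X r) ≤ k ^ 2 := by
  classical
  rcases isEmpty_or_nonempty (Fin n) with hn | hn
  · have : n = 0 := (Fintype.card_fin n).symm.trans (Fintype.card_eq_zero_iff.2 hn)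
    exact (dominationNumber_le_card _).trans (by simp [this])
  let cell : Fin n → (Fin 2 → Fin k) := fun i => cellIndex k (X i)
  have hcell : ∀ i, cell (Function.invFun cell (cell i)) = cell i :=
    fun i => Function.invFun_eq ⟨i, rfl⟩
  refine (dominationNumber_le (isDominating_geometricGraph
    (D := Finset.univ.image (Function.invFun cell)) fun i => ?_)).trans
    (Finset.card_image_le.trans (by simp))
  refine ⟨_, Finset.mem_image_of_mem _ (Finset.mem_univ (cell i)), ?_⟩
  refine (dist_le_of_mem_gridCell (c := cell i) (mem_gridCell_cellIndex (hX i)) ?_).trans hk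
  have := mem_gridCell_cellIndex (k := k) (hX (Function.invFun cell (cell i)))
  rwa [show cellIndex k (X (Function.invFun cell (cell i))) = cell i from hcell i] at this

/-- If the side of a cell is at least `r`, a node dominates nodes of at most nine cells. -/
lemma card_image_cellIndex_le {n k : ℕ} [NeZero k] {X : Fin n → Plane} {r : ℝ} (hr : 0 ≤ r)
    (hX : ∀ i, X i ∈ unitSquare) (hk : r ≤ 1 / k) :
    (Finset.univ.image fun i => cellIndex k (X i)).card ≤
      9 * dominationNumber (geometricGraph X r) := by
  classical
  obtain ⟨D, hD, hcard⟩ := exists_isDominating_card_eq (geometricGraph X r)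
  let nbr : (Fin 2 → Fin k) → Finset (Fin 2 → Fin k) := fun c =>
    Fintype.piFinset fun i => Finset.univ.filter fun a : Fin k =>
      (a : ℕ) ≤ c i + 1 ∧ (c i : ℕ) ≤ a + 1
  have hnbr : ∀ c, (nbr c).card ≤ 9 := by
    intro c
    have h3 : ∀ i, (Finset.univ.filter fun a : Fin k =>
        (a : ℕ) ≤ c i + 1 ∧ (c i : ℕ) ≤ a + 1).card ≤ 3 := by
      intro i
      rw [← Finset.card_map Fin.valEmbedding]
      refine (Finset.card_le_card (t := Finset.Icc ((c i : ℕ) - 1) (c i + 1)) ?_).trans ?_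
      · intro a ha
        simp only [Finset.mem_map, Finset.mem_filter, Finset.mem_univ, true_and] at ha
        obtain ⟨b, hb, rfl⟩ := ha
        simp only [Fin.valEmbedding_apply, Finset.mem_Icc]
        omega
      · simp only [Nat.card_Icc]; omega
    simp only [nbr, Fintype.card_piFinset, Fin.prod_univ_two]
    exact Nat.mul_le_mul (h3 0) (h3 1)
  have hsub : (Finset.univ.image fun i => cellIndex k (X i)) ⊆
      D.biUnion fun u => nbr (cellIndex k (X u)) := by
    intro q hq
    obtain ⟨i, -, rfl⟩ := Finset.mem_image.1 hq
    obtain ⟨u, hu, hd⟩ := exists_dist_le_of_isDominating hr hD i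
    refine Finset.mem_biUnion.2 ⟨u, hu, ?_⟩
    simp only [nbr, Fintype.mem_piFinset, Finset.mem_filter, Finset.mem_univ, true_and]
    exact fun j => ⟨cellIndex_le_succ (hX u) (hd.trans hk) j,
      cellIndex_le_succ (hX i) (by rw [dist_comm]; exact hd.trans hk) j⟩
  rw [← hcard]
  calc _ ≤ _ := Finset.card_le_card hsub
    _ ≤ D.card * 9 := Finset.card_biUnion_le_card_mul _ _ _ fun u _ => hnbr _
    _ = _ := mul_comm _ _

/-! ### Areas of triangles -/

/-- Twice the signed area of the triangle `a b c`. -/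
def signedArea₂ (a b c : Plane) : ℝ :=
  (b 0 - a 0) * (c 1 - a 1) - (b 1 - a 1) * (c 0 - a 0)

lemma volume_standard_triangle_le :
    volume {p : Plane | 0 ≤ p 0 ∧ 0 ≤ p 1 ∧ p 0 + p 1 ≤ 1} ≤ ENNReal.ofReal (1 / 2) := by
  set T : Set (ℝ × ℝ) := {z | 0 ≤ z.1 ∧ 0 ≤ z.2 ∧ z.1 + z.2 ≤ 1}
  have hT : MeasurableSet T := by
    refine IsClosed.measurableSet ?_
    exact (isClosed_le continuous_const continuous_fst).inter
      ((isClosed_le continuous_const continuous_snd).inter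
        (isClosed_le (continuous_fst.add continuous_snd) continuous_const))
  have h : {p : Plane | 0 ≤ p 0 ∧ 0 ≤ p 1 ∧ p 0 + p 1 ≤ 1} =
      (WithLp.ofLp : Plane → Fin 2 → ℝ) ⁻¹' ((MeasurableEquiv.finTwoArrow : _ ≃ᵐ ℝ × ℝ) ⁻¹' T) := by
    ext p
    simp [T, MeasurableEquiv.finTwoArrow]
  have hm : MeasurableSet ((MeasurableEquiv.finTwoArrow : _ ≃ᵐ ℝ × ℝ) ⁻¹' T) :=
    MeasurableEquiv.finTwoArrow.measurable hT
  rw [h, (PiLp.volume_preserving_ofLp (Fin 2)).measure_preimage hm.nullMeasurableSet,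
    (volume_preserving_finTwoArrow ℝ).measure_preimage hT.nullMeasurableSet,
    Measure.volume_eq_prod, Measure.prod_apply hT]
  have hle : ∀ x : ℝ, volume (Prod.mk x ⁻¹' T) ≤
      (Set.Icc (0 : ℝ) 1).indicator (fun x => ENNReal.ofReal (1 - x)) x := by
    intro x
    by_cases hx : x ∈ Set.Icc (0 : ℝ) 1
    · rw [Set.indicator_of_mem hx]
      refine (measure_mono (t := Set.Icc 0 (1 - x)) ?_).trans (by simp)
      rintro y ⟨-, hy0, hy1⟩
      exact ⟨hy0, by simp only at hy1; linarith⟩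
    · rw [Set.indicator_of_notMem hx, nonpos_iff_eq_zero]
      convert measure_empty
      · ext y
        simp only [T, Set.mem_preimage, Set.mem_ofPred_eq, Set.mem_empty_iff_false, iff_false]
        rintro ⟨h0, h1, h2⟩
        exact hx ⟨h0, by linarith⟩
      · infer_instance
  refine (lintegral_mono hle).trans ?_
  rw [lintegral_indicator measurableSet_Icc, ← ofReal_integral_eq_lintegral_ofReal]
  · refine ENNReal.ofReal_le_ofReal (le_of_eq ?_)
    rw [integral_Icc_eq_integral_Ioc, ← intervalIntegral.integral_of_le zero_le_one]
    rw [intervalIntegral.integral_sub (by simp) (by simp)]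
    simp
    norm_num
  · exact (by fun_prop : Continuous fun x : ℝ => 1 - x).continuousOn.integrableOn_Icc
  · filter_upwards [ae_restrict_mem measurableSet_Icc] with x hx
    simpa using hx.2

lemma volume_convexHull_triangle_le (a b c : Plane) :
    volume (convexHull ℝ {a, b, c}) ≤ ENNReal.ofReal (|signedArea₂ a b c| / 2) := by
  set M : Matrix (Fin 2) (Fin 2) ℝ := !![b 0 - a 0, c 0 - a 0; b 1 - a 1, c 1 - a 1]
  set L : Plane →ₗ[ℝ] Plane := Matrix.toEuclideanLin M
  have hdet : LinearMap.det L = signedArea₂ a b c := by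
    simp only [L, Matrix.toEuclideanLin_eq_toLin_orthonormal, LinearMap.det_toLin, M,
      Matrix.det_fin_two_of, signedArea₂]
    ring
  have hsub : convexHull ℝ {a, b, c} ⊆
      (fun p => a + p) '' (L '' {p : Plane | 0 ≤ p 0 ∧ 0 ≤ p 1 ∧ p 0 + p 1 ≤ 1}) := by
    intro x hx
    rw [convexHull_insert (by simp), convexHull_pair] at hx
    simp only [mem_convexJoin, Set.mem_singleton_iff, exists_eq_left] at hx
    obtain ⟨y, ⟨s, t, hs, ht, hst, rfl⟩, ⟨s', t', hs', ht', hst', rfl⟩⟩ := hx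
    refine ⟨_, ⟨!₂[t' * s, t' * t], ⟨?_, ?_, ?_⟩, rfl⟩, ?_⟩
    · simp; positivity
    · simp; positivity
    · simp; nlinarith
    · have hs1 : s = 1 - t := by linarith
      have hs1' : s' = 1 - t' := by linarith
      subst hs1 hs1'
      ext i
      fin_cases i <;>
      · simp [L, M, Matrix.toLpLin_apply, Matrix.vecHead, Matrix.vecTail]
        ring
  refine (measure_mono hsub).trans ?_
  rw [Set.image_add_left, measure_preimage_add, Measure.addHaar_image_linearMap, hdet]
  refine (mul_le_mul_right volume_standard_triangle_le _).trans ?_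
  rw [← ENNReal.ofReal_mul (abs_nonneg _)]
  exact ENNReal.ofReal_le_ofReal (by linarith)

/-- Among the triangles inscribed in a circle of radius `ρ` the equilateral ones are largest. -/
lemma abs_signedArea₂_le {a b c v : Plane} {ρ : ℝ} (ha : dist a v = ρ) (hb : dist b v = ρ)
    (hc : dist c v = ρ) : |signedArea₂ a b c| ≤ 3 * √3 / 2 * ρ ^ 2 := by
  -- With the origin at `v` and `×` for the planar cross product, twice the area is
  -- `a × (b - c) + b × c`, and both summands are bounded by completing squares.
  have key : ∀ A₀ A₁ B₀ B₁ C₀ C₁ : ℝ, A₀ ^ 2 + A₁ ^ 2 = ρ ^ 2 → B₀ ^ 2 + B₁ ^ 2 = ρ ^ 2 →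
      C₀ ^ 2 + C₁ ^ 2 = ρ ^ 2 →
      (B₀ - A₀) * (C₁ - A₁) - (B₁ - A₁) * (C₀ - A₀) ≤ 3 * √3 / 2 * ρ ^ 2 := by
    intro A₀ A₁ B₀ B₁ C₀ C₁ hA hB hC
    set s := √3
    have hs : s ^ 2 = 3 := Real.sq_sqrt (by norm_num)
    have hs0 : 0 ≤ s := Real.sqrt_nonneg _
    have h1 : 0 ≤ s / 6 * ((B₀ - C₀ + s * A₁) ^ 2 + (B₁ - C₁ - s * A₀) ^ 2) := by positivity
    have h2 : 0 ≤ s / 3 * ((C₀ + B₀ / 2 + s / 2 * B₁) ^ 2 + (C₁ + B₁ / 2 - s / 2 * B₀) ^ 2) := by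
      positivity
    have e1 : s / 6 * ((B₀ - C₀ + s * A₁) ^ 2 + (B₁ - C₁ - s * A₀) ^ 2) =
        s / 6 * (2 * ρ ^ 2 - 2 * (B₀ * C₀ + B₁ * C₁)) + s / 2 * ρ ^ 2 +
          ((B₀ - C₀) * A₁ - (B₁ - C₁) * A₀) := by
      linear_combination (s / 6 * (A₀ ^ 2 + A₁ ^ 2) +
        ((B₀ - C₀) * A₁ - (B₁ - C₁) * A₀) / 3) * hs + s / 2 * hA + s / 6 * hB + s / 6 * hC
    have e2 : s / 3 * ((C₀ + B₀ / 2 + s / 2 * B₁) ^ 2 + (C₁ + B₁ / 2 - s / 2 * B₀) ^ 2) =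
        s / 3 * (2 * ρ ^ 2 + (B₀ * C₀ + B₁ * C₁)) + (C₀ * B₁ - C₁ * B₀) := by
      linear_combination (s / 12 * (B₀ ^ 2 + B₁ ^ 2) +
        (C₀ * B₁ - C₁ * B₀) / 3) * hs + s / 3 * hB + s / 3 * hC
    linarith
  have hsq : ∀ p : Plane, dist p v = ρ → (p 0 - v 0) ^ 2 + (p 1 - v 1) ^ 2 = ρ ^ 2 := by
    intro p hp
    rw [← dist_sq_eq, hp]
  have h1 := key _ _ _ _ _ _ (hsq a ha) (hsq b hb) (hsq c hc)
  have h2 := key _ _ _ _ _ _ (hsq a ha) (hsq c hc) (hsq b hb)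
  rw [signedArea₂, abs_le]
  constructor <;> linarith

/-! ### Delaunay triangles -/

/-- The set `s` of indices consists of all the sites `c i` on a circle of radius at most `R`
that has no site in its interior. -/
def IsDelaunay {ι : Type*} (c : ι → Plane) (R : ℝ) (s : Finset ι) : Prop :=
  ∃ (v : Plane) (ρ : ℝ), ρ ≤ R ∧ (∀ i, ρ ≤ dist (c i) v) ∧ ∀ i, i ∈ s ↔ dist (c i) v = ρ

lemma signedArea₂_ne_zero {a b c v : Plane} {ρ : ℝ} (ha : dist a v = ρ) (hb : dist b v = ρ)
    (hc : dist c v = ρ) (hab : a 0 < b 0) (hbc : b 0 < c 0) : signedArea₂ a b c ≠ 0 := by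
  intro h
  have ha' := dist_sq_eq a v
  have hb' := dist_sq_eq b v
  have hc' := dist_sq_eq c v
  rw [ha] at ha'
  rw [hb] at hb'
  rw [hc] at hc'
  rw [signedArea₂] at h
  have e : (c 0 - b 0) * ((a 0 - b 0) ^ 2 + (a 1 - b 1) ^ 2) +
      (b 0 - a 0) * ((c 0 - b 0) ^ 2 + (c 1 - b 1) ^ 2) = 0 := by
    linear_combination (c 0 - b 0) * (hb' - ha') + (b 0 - a 0) * (hb' - hc') -
      2 * (b 1 - v 1) * h
  have h1 : 0 < (c 0 - b 0) * ((a 0 - b 0) ^ 2 + (a 1 - b 1) ^ 2) := by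
    have : 0 < (a 0 - b 0) ^ 2 := by nlinarith
    exact mul_pos (by linarith) (by positivity)
  have h2 : 0 ≤ (b 0 - a 0) * ((c 0 - b 0) ^ 2 + (c 1 - b 1) ^ 2) :=
    mul_nonneg (by linarith) (by positivity)
  linarith

/-- A Delaunay set is determined by a site `j` of it that is neither leftmost nor rightmost,
together with the side of a chord on which this site lies. The difference of the powers of a point
with respect to the two empty circles is an affine function of the point; the signs that emptiness
forces on it at the sites make it vanish. -/
lemma IsDelaunay.eq_of_middle {ι : Type*} {c : ι → Plane} {R : ℝ} {s s' : Finset ι}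
    (hs : IsDelaunay c R s) (hs' : IsDelaunay c R s') {i j k i' k' : ι}
    (hi : i ∈ s) (hj : j ∈ s) (hk : k ∈ s) (hi' : i' ∈ s') (hj' : j ∈ s') (hk' : k' ∈ s')
    (hij : c i 0 < c j 0) (hjk : c j 0 < c k 0)
    (hside : 0 < signedArea₂ (c i) (c j) (c k) * signedArea₂ (c i') (c j) (c k'))
    (hij' : c i' 0 < c j 0) (hjk' : c j 0 < c k' 0) : s = s' := by
  obtain ⟨v, ρ, -, hmin, hmem⟩ := hs
  obtain ⟨v', ρ', -, hmin', hmem'⟩ := hs'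
  have hρ : 0 ≤ ρ := ((hmem j).1 hj) ▸ dist_nonneg
  have hρ' : 0 ≤ ρ' := ((hmem' j).1 hj') ▸ dist_nonneg
  set a : ℝ := 2 * (v' 0 - v 0)
  set b : ℝ := 2 * (v' 1 - v 1)
  set d : ℝ := v 0 ^ 2 + v 1 ^ 2 - ρ ^ 2 - (v' 0 ^ 2 + v' 1 ^ 2 - ρ' ^ 2)
  have hpow : ∀ l, a * c l 0 + b * c l 1 + d =
      (dist (c l) v ^ 2 - ρ ^ 2) - (dist (c l) v' ^ 2 - ρ' ^ 2) := by
    intro l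
    rw [dist_sq_eq, dist_sq_eq]
    ring
  have hle : ∀ l ∈ s, a * c l 0 + b * c l 1 + d ≤ 0 := by
    intro l hl
    rw [hpow, (hmem l).1 hl]
    have := pow_le_pow_left₀ hρ' (hmin' l) 2
    linarith
  have hge : ∀ l ∈ s', 0 ≤ a * c l 0 + b * c l 1 + d := by
    intro l hl
    rw [hpow, (hmem' l).1 hl]
    have := pow_le_pow_left₀ hρ (hmin l) 2
    linarith
  have h0 : a * c j 0 + b * c j 1 + d = 0 := le_antisymm (hle j hj) (hge j hj')
  have hb1 : b * signedArea₂ (c i) (c j) (c k) ≤ 0 := by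
    have e : b * signedArea₂ (c i) (c j) (c k) =
        (c k 0 - c j 0) * (a * c i 0 + b * c i 1 + d) +
          (c j 0 - c i 0) * (a * c k 0 + b * c k 1 + d) := by
      rw [signedArea₂]
      linear_combination (c i 0 - c k 0) * h0
    rw [e]
    exact add_nonpos (mul_nonpos_of_nonneg_of_nonpos (by linarith) (hle i hi))
      (mul_nonpos_of_nonneg_of_nonpos (by linarith) (hle k hk))
  have hb2 : 0 ≤ b * signedArea₂ (c i') (c j) (c k') := by
    have e : b * signedArea₂ (c i') (c j) (c k') =
        (c k' 0 - c j 0) * (a * c i' 0 + b * c i' 1 + d) +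
          (c j 0 - c i' 0) * (a * c k' 0 + b * c k' 1 + d) := by
      rw [signedArea₂]
      linear_combination (c i' 0 - c k' 0) * h0
    rw [e]
    exact add_nonneg (mul_nonneg (by linarith) (hge i' hi'))
      (mul_nonneg (by linarith) (hge k' hk'))
  have hb : b = 0 := by
    by_contra hne
    have h1 : 0 < b ^ 2 * (signedArea₂ (c i) (c j) (c k) * signedArea₂ (c i') (c j) (c k')) := by
      positivity
    have h2 := mul_nonpos_of_nonpos_of_nonneg hb1 hb2
    nlinarith
  have ha : a = 0 := by
    have h1 := hle i hi
    have h2 := hle k hk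
    rw [hb] at h0 h1 h2
    nlinarith
  have hd : d = 0 := by simpa [ha, hb] using h0
  have hpow0 : ∀ l, dist (c l) v ^ 2 - ρ ^ 2 = dist (c l) v' ^ 2 - ρ' ^ 2 := by
    intro l
    have := hpow l
    rw [ha, hb, hd] at this
    linarith
  ext l
  rw [hmem, hmem', ← sq_eq_sq₀ dist_nonneg hρ, ← sq_eq_sq₀ dist_nonneg hρ', ← sub_eq_zero,
    hpow0, sub_eq_zero]

open Classical in
lemma exists_middle {ι : Type*} {c : ι → Plane} (hc : Function.Injective fun i => c i 0)
    {s : Finset ι} (hs : s.card = 3) :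
    ∃ i j k, s = {i, j, k} ∧ c i 0 < c j 0 ∧ c j 0 < c k 0 := by
  have hne : s.Nonempty := Finset.card_pos.1 (by omega)
  obtain ⟨i, hi, himin⟩ := s.exists_min_image (fun l => c l 0) hne
  obtain ⟨k, hk, hkmax⟩ := s.exists_max_image (fun l => c l 0) hne
  obtain ⟨j, hj, hjik⟩ : ∃ j ∈ s, j ∉ ({i, k} : Finset ι) := by
    by_contra! h
    have h1 := Finset.card_le_card (show s ⊆ {i, k} from h)
    have h2 := Finset.card_le_two (a := i) (b := k)
    omega
  simp only [Finset.mem_insert, Finset.mem_singleton, not_or] at hjik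
  have h1 : c i 0 < c j 0 := lt_of_le_of_ne (himin j hj) fun e => hjik.1 (hc e.symm)
  have h2 : c j 0 < c k 0 := lt_of_le_of_ne (hkmax j hj) fun e => hjik.2 (hc e)
  refine ⟨i, j, k, ?_, h1, h2⟩
  refine (Finset.eq_of_subset_of_card_le ?_ ?_).symm
  · intro l hl
    simp only [Finset.mem_insert, Finset.mem_singleton] at hl
    rcases hl with rfl | rfl | rfl <;> assumption
  · have hik : i ≠ k := fun e => by rw [e] at h1; exact lt_asymm h1 h2
    rw [hs, Finset.card_eq_three.2 ⟨i, j, k, fun e => hjik.1 e.symm, hik, hjik.2, rfl⟩]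

open Classical in
/-- There are at most twice as many Delaunay triangles as sites: each site is the middle one,
in the order of first coordinates, of at most one triangle above it and of at most one below it. -/
lemma card_delaunay_triangles_le {ι : Type*} [Fintype ι] {c : ι → Plane}
    (hc : Function.Injective fun i => c i 0) (R : ℝ) :
    (Finset.univ.filter fun s : Finset ι => s.card = 3 ∧ IsDelaunay c R s).card ≤
      2 * Fintype.card ι := by
  rcases isEmpty_or_nonempty ι with hι | hι
  · rw [Finset.filter_eq_empty_iff.2]
    · simp
    · rintro s - ⟨h, -⟩
      rw [Finset.eq_empty_of_isEmpty s] at h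
      simp at h
  have hmid : ∀ s : Finset ι, s.card = 3 →
      ∃ i j k, s = {i, j, k} ∧ c i 0 < c j 0 ∧ c j 0 < c k 0 := fun s hs => exists_middle hc hs
  choose! i j k hs hij hjk using hmid
  have hcard : (Finset.univ : Finset (ι × Bool)).card = 2 * Fintype.card ι := by
    simp [mul_comm]
  rw [← hcard]
  refine Finset.card_le_card_of_injOn
    (fun s => (j s, decide (0 < signedArea₂ (c (i s)) (c (j s)) (c (k s)))))
    (fun _ _ => Finset.mem_univ _) ?_
  intro s h s' h' e
  simp only [Finset.coe_filter, Finset.mem_univ, true_and, Set.mem_ofPred_eq] at h h'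
  simp only [Prod.mk.injEq, decide_eq_decide] at e
  have hmem : ∀ s : Finset ι, s.card = 3 → i s ∈ s ∧ j s ∈ s ∧ k s ∈ s := by
    intro s h
    have e := Finset.ext_iff.1 (hs s h)
    exact ⟨(e _).2 (by simp), (e _).2 (by simp), (e _).2 (by simp)⟩
  have m1 := hmem s h.1
  have m2 := hmem s' h'.1
  have n1 : signedArea₂ (c (i s)) (c (j s)) (c (k s)) ≠ 0 := by
    obtain ⟨v, ρ, -, -, hm⟩ := h.2
    exact signedArea₂_ne_zero ((hm _).1 m1.1) ((hm _).1 m1.2.1) ((hm _).1 m1.2.2)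
      (hij s h.1) (hjk s h.1)
  have n2 : signedArea₂ (c (i s')) (c (j s')) (c (k s')) ≠ 0 := by
    obtain ⟨v, ρ, -, -, hm⟩ := h'.2
    exact signedArea₂_ne_zero ((hm _).1 m2.1) ((hm _).1 m2.2.1) ((hm _).1 m2.2.2)
      (hij s' h'.1) (hjk s' h'.1)
  have hside : 0 < signedArea₂ (c (i s)) (c (j s)) (c (k s)) *
      signedArea₂ (c (i s')) (c (j s')) (c (k s')) := by
    rcases n1.lt_or_gt with h1 | h1
    · have : signedArea₂ (c (i s')) (c (j s')) (c (k s')) < 0 :=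
        lt_of_le_of_ne (not_lt.1 fun h2 => absurd (e.2.2 h2) (not_lt.2 h1.le)) n2
      exact mul_pos_of_neg_of_neg h1 this
    · exact mul_pos h1 (e.2.1 h1)
  have hj' := e.1
  have a1 := hij s' h'.1
  have a2 := hjk s' h'.1
  have m3 := m2.2.1
  rw [← hj'] at hside a1 a2 m3
  exact h.2.eq_of_middle h'.2 m1.1 m1.2.1 m1.2.2 m2.1 m3 m2.2.2 (hij s h.1) (hjk s h.1)
    hside a1 a2

/-! ### Sites in general position -/

/-- The sites have distinct first coordinates, and no four of them lie on a circle. -/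
def IsGeneric {ι : Type*} (c : ι → Plane) : Prop :=
  (Function.Injective fun i => c i 0) ∧
    ∀ (s : Finset ι) (v : Plane) (ρ : ℝ), (∀ i ∈ s, dist (c i) v = ρ) → s.card ≤ 3

lemma volume_vertical_line (a : ℝ) : volume {p : Plane | p 0 = a} = 0 := by
  have h : {p : Plane | p 0 = a} ⊆
      ⋃ m : ℕ, {p : Plane | ∀ i, p i ∈ Set.Icc (![a, -m] i) (![a, m] i)} := by
    intro p hp
    obtain ⟨m, hm⟩ := exists_nat_ge |p 1|
    refine Set.mem_iUnion.2 ⟨m, fun i => ?_⟩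
    have hp' : p 0 = a := hp
    fin_cases i
    · simp [hp']
    · simpa using abs_le.1 hm
  refine measure_mono_null h (measure_iUnion_null fun m => ?_)
  rw [volume_box]
  simp [Fin.prod_univ_two]

/-- The points cocircular with three given points of a circle form a null set, since these three
points determine the circle. -/
lemma volume_cocircular {ι : Type*} {c : ι → Plane} (hc : Function.Injective c) {t : Finset ι}
    (ht : t.card = 3) :
    volume {p : Plane | ∃ (v : Plane) (ρ : ℝ), (∀ i ∈ t, dist (c i) v = ρ) ∧ dist p v = ρ} = 0 := by
  classical
  rcases Set.eq_empty_or_nonempty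
    {p : Plane | ∃ (v : Plane) (ρ : ℝ), (∀ i ∈ t, dist (c i) v = ρ) ∧ dist p v = ρ} with h | h
  · rw [h, measure_empty]
  obtain ⟨p₀, v, ρ, hv, -⟩ := h
  refine measure_mono_null (t := Metric.sphere v ρ) ?_ (Measure.addHaar_sphere volume v ρ)
  rintro p ⟨v', ρ', hv', hp⟩
  have heq : (⟨v, ρ⟩ : EuclideanGeometry.Sphere Plane) = ⟨v', ρ'⟩ := by
    by_contra hne
    obtain ⟨i, j, k, hij, hik, hjk, rfl⟩ := Finset.card_eq_three.1 ht
    have := EuclideanGeometry.eq_of_mem_sphere_of_mem_sphere_of_finrank_eq_two (by simp) hne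
      (hc.ne hij) (p := c k) (hv i (by simp)) (hv j (by simp)) (hv k (by simp))
      (hv' i (by simp)) (hv' j (by simp)) (hv' k (by simp))
    rcases this with h | h
    · exact hik (hc h).symm
    · exact hjk (hc h).symm
  simp only [EuclideanGeometry.Sphere.mk.injEq] at heq
  rw [heq.1, heq.2]
  exact hp

/-- Arbitrarily small perturbations bring finitely many sites into general position. -/
lemma exists_isGeneric_near (N : ℕ) (c : Fin N → Plane) {ε : ℝ} (hε : 0 < ε) :
    ∃ c' : Fin N → Plane, (∀ i, dist (c i) (c' i) < ε) ∧ IsGeneric c' := by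
  classical
  induction N with
  | zero =>
    exact ⟨c, fun i => i.elim0, fun i => i.elim0, fun s _ _ _ => by
      rw [Finset.eq_empty_of_isEmpty s]; simp⟩
  | succ N ih =>
    obtain ⟨c', hnear, hinj, hcirc⟩ := ih fun i => c i.castSucc
    have hinj' : Function.Injective c' := fun i j h => hinj (by simp [h])
    set B : Set Plane := (⋃ i, {p : Plane | p 0 = c' i 0}) ∪
      ⋃ t ∈ (Finset.univ.filter fun t : Finset (Fin N) => t.card = 3),
        {p : Plane | ∃ (v : Plane) (ρ : ℝ), (∀ i ∈ t, dist (c' i) v = ρ) ∧ dist p v = ρ}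
    have hB : volume B = 0 := by
      refine measure_union_null (measure_iUnion_null fun i => volume_vertical_line _) ?_
      refine (measure_biUnion_null_iff (Finset.countable_toSet _)).2 fun t ht => ?_
      exact volume_cocircular hinj' (by simpa using ht)
    obtain ⟨p, hp, hpB⟩ : ∃ p ∈ Metric.ball (c (Fin.last N)) ε, p ∉ B := by
      by_contra! h
      exact (Metric.measure_ball_pos volume (c (Fin.last N)) hε).ne' (measure_mono_null h hB)
    simp only [B, Set.mem_union, Set.mem_iUnion, not_or, not_exists] at hpB
    obtain ⟨hp1, hp2⟩ := hpB
    refine ⟨Fin.snoc c' p, fun i => ?_, ?_, ?_⟩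
    · refine Fin.lastCases ?_ (fun i => ?_) i
      · rw [Fin.snoc_last, dist_comm]; exact hp
      · rw [Fin.snoc_castSucc]; exact hnear i
    · intro i j
      refine Fin.lastCases ?_ (fun i => ?_) i <;> refine Fin.lastCases ?_ (fun j => ?_) j
      · simp
      · intro h
        simp only [Fin.snoc_last, Fin.snoc_castSucc] at h
        exact absurd h (hp1 j)
      · intro h
        simp only [Fin.snoc_last, Fin.snoc_castSucc] at h
        exact absurd h.symm (hp1 i)
      · intro h
        simp only [Fin.snoc_castSucc] at h
        rw [hinj h]
    · intro s v ρ hs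
      set s₀ : Finset (Fin N) := Finset.univ.filter fun i => i.castSucc ∈ s
      have hs₀ : ∀ i ∈ s₀, dist (c' i) v = ρ := by
        intro i hi
        simpa using hs i.castSucc (by simpa [s₀] using hi)
      have h3 := hcirc s₀ v ρ hs₀
      have hle : s ⊆ insert (Fin.last N) (s₀.map Fin.castSuccEmb) := by
        intro i
        refine Fin.lastCases ?_ (fun i => ?_) i
        · simp
        · intro hi
          simpa [s₀, (Fin.castSucc_lt_last i).ne] using hi
      by_cases hl : Fin.last N ∈ s
      · by_contra! h4
        have h5 := (Finset.card_le_card hle).trans (Finset.card_insert_le _ _)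
        rw [Finset.card_map] at h5
        refine hp2 s₀ (by simp; omega) ⟨v, ρ, hs₀, ?_⟩
        simpa using hs _ hl
      · have hle' : s ⊆ s₀.map Fin.castSuccEmb := fun i hi =>
          (Finset.mem_insert.1 (hle hi)).resolve_left fun e => hl (e ▸ hi)
        have := Finset.card_le_card hle'
        rw [Finset.card_map] at this
        omega

/-! ### Covering density of discs -/

/-- Every point `x` of the square that is far from the boundary lies in the convex hull of a
Delaunay set. The centre of the empty circle is found by maximising
`minᵢ |cᵢ - v|² - |x - v|²`, a concave function of `v`. -/
lemma exists_isDelaunay_mem_convexHull {ι : Type*} [Fintype ι] {c : ι → Plane} {R R' : ℝ}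
    (hR : 0 ≤ R) (hRR : R < R') (hcov : ∀ y ∈ unitSquare, ∃ i, dist y (c i) ≤ R) {x : Plane}
    (hx : ∀ i, x i ∈ Set.Icc R' (1 - R')) :
    ∃ s : Finset ι, IsDelaunay c R s ∧ x ∈ convexHull ℝ (c '' s) := by
  classical
  have hball : ∀ v ∈ Metric.closedBall x R', v ∈ unitSquare := by
    intro v hv i
    have h1 := (abs_coord_sub_le v x i).trans hv
    have h2 := abs_le.1 h1
    have h3 := hx i
    exact ⟨by linarith [h3.1], by linarith [h3.2]⟩
  have hxball : x ∈ Metric.closedBall x R' := Metric.mem_closedBall_self (by linarith)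
  have hne : (Set.range c).Nonempty := by
    obtain ⟨i, -⟩ := hcov x (hball x hxball)
    exact ⟨c i, i, rfl⟩
  have hinf : ∀ v ∈ unitSquare, Metric.infDist v (Set.range c) ≤ R := by
    intro v hv
    obtain ⟨i, hi⟩ := hcov v hv
    exact (Metric.infDist_le_dist_of_mem (Set.mem_range_self i)).trans hi
  set g : Plane → ℝ := fun v => Metric.infDist v (Set.range c) ^ 2 - dist x v ^ 2
  have hg : Continuous g := by
    have := Metric.continuous_infDist_pt (Set.range c)
    fun_prop
  obtain ⟨v, hvball, hmax⟩ := (isCompact_closedBall x R').exists_isMaxOn ⟨x, hxball⟩ hg.continuousOn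
  have hvlt : dist x v < R' := by
    have h1 : g x ≤ g v := hmax hxball
    have h2 : 0 ≤ g x := by simp [g, sq_nonneg]
    have h3 := hinf v (hball v hvball)
    have h4 : 0 ≤ Metric.infDist v (Set.range c) := Metric.infDist_nonneg
    have h5 : 0 ≤ Metric.infDist v (Set.range c) ^ 2 - dist x v ^ 2 := h2.trans h1
    nlinarith [dist_nonneg (x := x) (y := v)]
  set ρ := Metric.infDist v (Set.range c) with hρ
  have hmin : ∀ i, ρ ≤ dist (c i) v := fun i => by
    rw [dist_comm]; exact Metric.infDist_le_dist_of_mem (Set.mem_range_self i)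
  refine ⟨Finset.univ.filter fun i => dist (c i) v = ρ,
    ⟨v, ρ, hinf v (hball v hvball), hmin, by simp⟩, ?_⟩
  set K := convexHull ℝ (c '' (Finset.univ.filter fun i => dist (c i) v = ρ : Finset ι))
  by_contra hxK
  have hK : IsClosed K := Set.Finite.isClosed_convexHull ℝ ((Finset.finite_toSet _).image c)
  obtain ⟨f, u, hfK, hfx⟩ := geometric_hahn_banach_closed_point (convex_convexHull ℝ _) hK hxK
  set w : Plane := (InnerProductSpace.toDual ℝ Plane).symm f
  have hw : ∀ y, f y = inner ℝ w y := fun y => by simp [w]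
  -- Moving `v` in the direction `w` increases `|cᵢ - v|² - |x - v|²` for every nearest site `cᵢ`.
  have hmove : ∀ (τ : ℝ) (y : Plane), dist y (v + τ • w) ^ 2 - dist x (v + τ • w) ^ 2 =
      (dist y v ^ 2 - dist x v ^ 2) + 2 * τ * (f x - f y) := by
    intro τ y
    rw [hw, hw]
    simp only [dist_sq_eq, PiLp.inner_apply, Fin.sum_univ_two, PiLp.add_apply, PiLp.smul_apply,
      smul_eq_mul, RCLike.inner_apply, conj_trivial]
    ring
  have hev : ∀ i, ∀ᶠ τ : ℝ in 𝓝[>] 0,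
      g v < dist (c i) (v + τ • w) ^ 2 - dist x (v + τ • w) ^ 2 := by
    intro i
    rcases (hmin i).eq_or_lt with h | h
    · filter_upwards [self_mem_nhdsWithin] with τ hτ
      have hτ' : (0 : ℝ) < τ := hτ
      have : f (c i) < u := hfK _ (subset_convexHull ℝ _ ⟨i, by simp [h], rfl⟩)
      rw [hmove, ← h]
      have : 0 < 2 * τ * (f x - f (c i)) := mul_pos (by linarith) (by linarith)
      simp only [g, ← hρ]
      linarith
    · refine Eventually.filter_mono nhdsWithin_le_nhds ?_
      have hcont : Continuous fun τ : ℝ =>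
          dist (c i) (v + τ • w) ^ 2 - dist x (v + τ • w) ^ 2 := by fun_prop
      refine hcont.continuousAt.eventually (lt_mem_nhds ?_)
      simp only [g, ← hρ, zero_smul, add_zero]
      have : ρ ^ 2 < dist (c i) v ^ 2 := pow_lt_pow_left₀ h Metric.infDist_nonneg two_ne_zero
      linarith
  have hev' : ∀ᶠ τ : ℝ in 𝓝[>] 0, dist x (v + τ • w) < R' := by
    refine Eventually.filter_mono nhdsWithin_le_nhds ?_
    have hcont : Continuous fun τ : ℝ => dist x (v + τ • w) := by fun_prop
    refine hcont.continuousAt.eventually (gt_mem_nhds ?_)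
    simpa using hvlt
  obtain ⟨τ, hτ1, hτ2⟩ := ((eventually_all.2 hev).and hev').exists
  obtain ⟨_, ⟨i, rfl⟩, hi⟩ :=
    (Set.finite_range c).isCompact.exists_infDist_eq_dist hne (v + τ • w)
  have h1 : g (v + τ • w) ≤ g v := hmax (by rw [Metric.mem_closedBall, dist_comm]; exact hτ2.le)
  have h2 := hτ1 i
  have h3 : g (v + τ • w) = dist (c i) (v + τ • w) ^ 2 - dist x (v + τ • w) ^ 2 := by
    simp only [g]
    rw [hi, dist_comm (c i)]
  linarith

lemma IsDelaunay.volume_convexHull_le {ι : Type*} {c : ι → Plane} {R : ℝ} {s : Finset ι}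
    (hs : IsDelaunay c R s) (hcard : s.card = 3) :
    volume (convexHull ℝ (c '' s)) ≤ ENNReal.ofReal (3 * √3 / 4 * R ^ 2) := by
  classical
  obtain ⟨v, ρ, hρR, -, hmem⟩ := hs
  obtain ⟨i, j, k, -, -, -, rfl⟩ := Finset.card_eq_three.1 hcard
  have hi := (hmem i).1 (by simp)
  have hρ : 0 ≤ ρ := hi ▸ dist_nonneg
  have h := abs_signedArea₂_le hi ((hmem j).1 (by simp)) ((hmem k).1 (by simp))
  have himage : c '' (({i, j, k} : Finset ι) : Set ι) = {c i, c j, c k} := by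
    simp [Set.image_insert_eq]
  rw [himage]
  refine (volume_convexHull_triangle_le _ _ _).trans (ENNReal.ofReal_le_ofReal ?_)
  have h1 : 3 * √3 / 4 * ρ ^ 2 ≤ 3 * √3 / 4 * R ^ 2 := by gcongr
  linarith

lemma volume_convexHull_eq_zero_of_card_le_two {ι : Type*} (c : ι → Plane) {s : Finset ι}
    (hcard : s.card ≤ 2) : volume (convexHull ℝ (c '' s)) = 0 := by
  classical
  have key : ∀ a b : Plane, volume (convexHull ℝ {a, b}) = 0 := by
    intro a b
    have := volume_convexHull_triangle_le a b b
    rw [Set.pair_eq_singleton, show signedArea₂ a b b = 0 by rw [signedArea₂]; ring] at this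
    simpa using this
  interval_cases h : s.card
  · simp [Finset.card_eq_zero.1 h]
  · obtain ⟨i, rfl⟩ := Finset.card_eq_one.1 h
    simp
  · obtain ⟨i, j, -, rfl⟩ := Finset.card_eq_two.1 h
    simpa [Set.image_insert_eq] using key (c i) (c j)

lemma covering_bound_of_isGeneric {N : ℕ} {c : Fin N → Plane} (hc : IsGeneric c) {R R' : ℝ}
    (hR : 0 ≤ R) (hRR : R < R') (hR' : 2 * R' ≤ 1)
    (hcov : ∀ y ∈ unitSquare, ∃ i, dist y (c i) ≤ R) :
    (1 - 2 * R') ^ 2 ≤ N * (3 * √3 / 2 * R ^ 2) := by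
  classical
  set D : Finset (Finset (Fin N)) := Finset.univ.filter fun s => s.card = 3 ∧ IsDelaunay c R s
  set E : Finset (Finset (Fin N)) := Finset.univ.filter fun s => s.card ≤ 2
  have hsub : {p : Plane | ∀ i, p i ∈ Set.Icc R' (1 - R')} ⊆
      (⋃ s ∈ D, convexHull ℝ (c '' s)) ∪ ⋃ s ∈ E, convexHull ℝ (c '' s) := by
    intro x hx
    obtain ⟨s, hs, hxs⟩ := exists_isDelaunay_mem_convexHull hR hRR hcov hx
    have h3 : s.card ≤ 3 := by
      obtain ⟨v, ρ, -, -, hmem⟩ := hs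
      exact hc.2 s v ρ fun i hi => (hmem i).1 hi
    rcases h3.eq_or_lt with h | h
    · exact Or.inl (Set.mem_biUnion (show s ∈ D by simp [D, h, hs]) hxs)
    · exact Or.inr (Set.mem_biUnion (show s ∈ E by simp [E]; omega) hxs)
  have hE : volume (⋃ s ∈ E, convexHull ℝ (c '' s)) = 0 :=
    (measure_biUnion_null_iff (Finset.countable_toSet _)).2 fun s hs =>
      volume_convexHull_eq_zero_of_card_le_two c (by simpa [E] using hs)
  have hD : volume (⋃ s ∈ D, convexHull ℝ (c '' s)) ≤
      ENNReal.ofReal (N * (3 * √3 / 2 * R ^ 2)) := by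
    refine (measure_biUnion_finset_le D _).trans ?_
    refine (Finset.sum_le_card_nsmul _ _ (ENNReal.ofReal (3 * √3 / 4 * R ^ 2)) fun s hs => ?_).trans
      ?_
    · have hs' := (Finset.mem_filter.1 hs).2
      exact hs'.2.volume_convexHull_le hs'.1
    · rw [nsmul_eq_mul, ← ENNReal.ofReal_natCast, ← ENNReal.ofReal_mul (by positivity)]
      refine ENNReal.ofReal_le_ofReal ?_
      have h1 : D.card ≤ 2 * N := by
        have := card_delaunay_triangles_le hc.1 R
        rw [Fintype.card_fin] at this
        convert this
      have h2 : (D.card : ℝ) ≤ 2 * N := by exact_mod_cast h1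
      calc (D.card : ℝ) * (3 * √3 / 4 * R ^ 2) ≤ 2 * N * (3 * √3 / 4 * R ^ 2) := by gcongr
        _ = _ := by ring
  have h := (measure_mono (μ := volume) hsub).trans (measure_union_le _ _)
  rw [hE, add_zero, volume_box, Fin.prod_univ_two, ← ENNReal.ofReal_mul (by linarith)] at h
  have h' := (ENNReal.ofReal_le_ofReal_iff (by positivity)).1 (h.trans hD)
  calc (1 - 2 * R') ^ 2 = (1 - R' - R') * (1 - R' - R') := by ring
    _ ≤ _ := h'

/-- Kershner's bound: discs covering the square have total area at least `2π√3/9` times the area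
of the square, up to a boundary effect. -/
theorem covering_lower_bound {C : Finset Plane} {R R' : ℝ} (hR : 0 ≤ R) (hRR : R < R')
    (hR' : 2 * R' ≤ 1) (hcov : ∀ y ∈ unitSquare, ∃ c ∈ C, dist y c ≤ R) :
    (1 - 2 * R') ^ 2 ≤ C.card * (3 * √3 / 2 * R' ^ 2) := by
  set e := C.equivFin
  obtain ⟨c', hnear, hgen⟩ := exists_isGeneric_near C.card (fun i => (e.symm i : Plane))
    (show (0 : ℝ) < (R' - R) / 2 by linarith)
  have hcov' : ∀ y ∈ unitSquare, ∃ i, dist y (c' i) ≤ (R + R') / 2 := by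
    intro y hy
    obtain ⟨p, hp, hd⟩ := hcov y hy
    refine ⟨e ⟨p, hp⟩, ?_⟩
    have h1 := hnear (e ⟨p, hp⟩)
    rw [Equiv.symm_apply_apply] at h1
    have h2 := dist_triangle y p (c' (e ⟨p, hp⟩))
    dsimp only at h1
    linarith
  refine (covering_bound_of_isGeneric hgen (by linarith) (by linarith) hR' hcov').trans ?_
  have h1 : (R + R') / 2 ≤ R' := by linarith
  have h0 : 0 ≤ (R + R') / 2 := by linarith
  gcongr

/-! ### The hexagonal covering -/

/-- In a rectangle with side lengths `√3/2` and `3/2` every point has distance at most one from one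
of the two ends of a diagonal. -/
lemma sq_add_sq_le_one_or {s t : ℝ} (hs : 0 ≤ s) (hs' : s ≤ √3 / 2) (ht : 0 ≤ t)
    (ht' : t ≤ 3 / 2) : s ^ 2 + t ^ 2 ≤ 1 ∨ (√3 / 2 - s) ^ 2 + (3 / 2 - t) ^ 2 ≤ 1 := by
  have h3 : √3 ^ 2 = 3 := Real.sq_sqrt (by norm_num)
  have key : ∀ s t : ℝ, 0 ≤ s → s ≤ √3 / 2 → 0 ≤ t → 3 * t + √3 * s ≤ 3 → s ^ 2 + t ^ 2 ≤ 1 := by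
    intro s t hs hs' ht h
    have h1 : t ^ 2 ≤ (1 - √3 * s / 3) ^ 2 := pow_le_pow_left₀ ht (by linarith) 2
    have h2 : 0 ≤ s * (√3 / 2 - s) := mul_nonneg hs (by linarith)
    nlinarith
  rcases le_total (3 * t + √3 * s) 3 with h | h
  · exact Or.inl (key s t hs hs' ht h)
  · refine Or.inr (key _ _ (by linarith) (by linarith) (by linarith) ?_)
    nlinarith

/-- The rows of the triangular lattice with side `√3 x` have distance `3x/2`, and every second row
is shifted by half a side. The discs of radius `x` about its points cover the plane. -/
lemma exists_hexagonal_cover {x : ℝ} (hx : 0 < x) :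
    ∃ C : Finset Plane, (∀ y ∈ unitSquare, ∃ c ∈ C, dist y c ≤ x) ∧
      (C.card : ℝ) ≤ (2 / (3 * x) + 2) * (1 / (√3 * x) + 2) := by
  classical
  have h3 : 0 < √3 := Real.sqrt_pos.2 (by norm_num)
  set M := ⌊2 / (3 * x)⌋₊
  set P := ⌊2 / (√3 * x)⌋₊
  set F : ℕ × ℕ → Plane := fun z =>
    !₂[((2 * z.2 + z.1 % 2 : ℕ) : ℝ) * (√3 / 2) * x, (z.1 : ℝ) * (3 / 2) * x]
  refine ⟨(Finset.range (M + 2) ×ˢ Finset.range ((P + 1) / 2 + 1)).image F, ?_, ?_⟩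
  · intro y hy
    have h0 := hy 0
    have h1 := hy 1
    suffices h : ∃ a m : ℕ, a ≤ P + 1 ∧ m ≤ M + 1 ∧ a % 2 = m % 2 ∧
        (y 0 / x - a * (√3 / 2)) ^ 2 + (y 1 / x - m * (3 / 2)) ^ 2 ≤ 1 by
      obtain ⟨a, m, ha, hm, ham, hd⟩ := h
      refine ⟨F (m, a / 2), Finset.mem_image_of_mem F ?_, ?_⟩
      · simp only [Finset.mem_product, Finset.mem_range]
        omega
      · have e : 2 * (a / 2) + m % 2 = a := by omega
        rw [dist_le_iff_sq hx.le]
        simp only [F, e, Matrix.cons_val_zero, Matrix.cons_val_one]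
        have e2 : (y 0 - a * (√3 / 2) * x) ^ 2 + (y 1 - m * (3 / 2) * x) ^ 2 =
            x ^ 2 * ((y 0 / x - a * (√3 / 2)) ^ 2 + (y 1 / x - m * (3 / 2)) ^ 2) := by
          field_simp
        rw [e2]
        nlinarith [sq_nonneg x]
    set p := ⌊y 0 / (√3 / 2 * x)⌋₊
    set m := ⌊y 1 / (3 / 2 * x)⌋₊
    have hp1 : (p : ℝ) ≤ y 0 / (√3 / 2 * x) := Nat.floor_le (div_nonneg h0.1 (by positivity))
    have hp2 : y 0 / (√3 / 2 * x) < p + 1 := Nat.lt_floor_add_one _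
    have hm1 : (m : ℝ) ≤ y 1 / (3 / 2 * x) := Nat.floor_le (div_nonneg h1.1 (by positivity))
    have hm2 : y 1 / (3 / 2 * x) < m + 1 := Nat.lt_floor_add_one _
    have hpP : p ≤ P := by
      refine Nat.floor_le_floor ?_
      calc y 0 / (√3 / 2 * x) ≤ 1 / (√3 / 2 * x) := by gcongr; exact h0.2
        _ = _ := by field_simp
    have hmM : m ≤ M := by
      refine Nat.floor_le_floor ?_
      calc y 1 / (3 / 2 * x) ≤ 1 / (3 / 2 * x) := by gcongr; exact h1.2
        _ = _ := by field_simp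
    set s := y 0 / x - p * (√3 / 2)
    set t := y 1 / x - m * (3 / 2)
    have e0 : y 0 / (√3 / 2 * x) * (√3 / 2) = y 0 / x := by field_simp
    have e1 : y 1 / (3 / 2 * x) * (3 / 2) = y 1 / x := by field_simp
    have hs : 0 ≤ s := by
      have := mul_le_mul_of_nonneg_right hp1 (show 0 ≤ √3 / 2 by positivity)
      simp only [s]; linarith
    have hs' : s ≤ √3 / 2 := by
      have := mul_le_mul_of_nonneg_right hp2.le (show 0 ≤ √3 / 2 by positivity)
      simp only [s]; linarith
    have ht : 0 ≤ t := by simp only [t]; linarith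
    have ht' : t ≤ 3 / 2 := by simp only [t]; linarith
    by_cases hpar : p % 2 = m % 2
    · rcases sq_add_sq_le_one_or hs hs' ht ht' with h | h
      · exact ⟨p, m, by omega, by omega, hpar, h⟩
      · refine ⟨p + 1, m + 1, by omega, by omega, by omega, ?_⟩
        push_cast
        calc _ = (√3 / 2 - s) ^ 2 + (3 / 2 - t) ^ 2 := by ring
          _ ≤ 1 := h
    · rcases sq_add_sq_le_one_or (sub_nonneg.2 hs') (by linarith) ht ht' with h | h
      · refine ⟨p + 1, m, by omega, by omega, by omega, ?_⟩
        push_cast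
        calc _ = (√3 / 2 - s) ^ 2 + t ^ 2 := by ring
          _ ≤ 1 := h
      · refine ⟨p, m + 1, by omega, by omega, by omega, ?_⟩
        push_cast
        calc _ = (√3 / 2 - (√3 / 2 - s)) ^ 2 + (3 / 2 - t) ^ 2 := by ring
          _ ≤ 1 := h
  · have hcard := Finset.card_image_le (s := Finset.range (M + 2) ×ˢ Finset.range ((P + 1) / 2 + 1))
      (f := F)
    rw [Finset.card_product, Finset.card_range, Finset.card_range] at hcard
    have hM : (M : ℝ) ≤ 2 / (3 * x) := Nat.floor_le (by positivity)
    have hP : (P : ℝ) ≤ 2 / (√3 * x) := Nat.floor_le (by positivity)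
    have hP2 : (((P + 1) / 2 : ℕ) : ℝ) ≤ (P + 1) / 2 := by
      have := Nat.cast_div_le (α := ℝ) (m := P + 1) (n := 2)
      push_cast at this
      exact this
    have e : 2 / (√3 * x) = 2 * (1 / (√3 * x)) := by ring
    calc _ ≤ (((M + 2) * ((P + 1) / 2 + 1) : ℕ) : ℝ) := by exact_mod_cast hcard
      _ = ((M : ℝ) + 2) * ((((P + 1) / 2 : ℕ) : ℝ) + 1) := by push_cast; ring
      _ ≤ _ := mul_le_mul (by linarith) (by linarith) (by positivity) (by positivity)

/-! ### Density of the nodes -/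

/-- A radius such that a.a.s. every disc of this radius with its centre in the square contains a
node. The factor `4` leaves room for a union bound over the cells of a grid. -/
noncomputable def denseScale (n : ℕ) : ℝ := 4 * √(Real.log n / n)

lemma exists_bad_not_dense : ∀ᶠ n : ℕ in atTop, ∃ B : Set (Fin n → Plane),
    pointsLaw n B ≤ ENNReal.ofReal (1 / (n : ℝ)) ∧
    ∀ X : Fin n → Plane, X ∉ B → ∀ y ∈ unitSquare, ∃ i, dist y (X i) ≤ denseScale n := by
  have hlog : ∀ᶠ n : ℕ in atTop, ‖Real.log (n : ℝ)‖ ≤ 1 / 8 * ‖(n : ℝ)‖ :=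
    (Real.isLittleO_log_id_atTop.comp_tendsto tendsto_natCast_atTop_atTop).bound (by norm_num)
  have hlog1 : ∀ᶠ n : ℕ in atTop, 1 ≤ Real.log (n : ℝ) :=
    (Real.tendsto_log_atTop.comp tendsto_natCast_atTop_atTop).eventually_ge_atTop 1
  filter_upwards [hlog, hlog1, eventually_gt_atTop 0] with n h8 h1 hn
  have hn' : (0 : ℝ) < n := by exact_mod_cast hn
  have hl : 0 < Real.log (n : ℝ) := by linarith
  rw [Real.norm_of_nonneg hl.le, Real.norm_of_nonneg hn'.le] at h8
  -- With this `k` a cell has expected number of nodes at least `2 log n`.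
  set z := √(n / (2 * Real.log n))
  have hz2 : z ^ 2 = n / (2 * Real.log n) := Real.sq_sqrt (by positivity)
  have hz : 2 ≤ z := by
    refine Real.le_sqrt_of_sq_le ?_
    rw [le_div_iff₀ (by positivity)]
    linarith
  set k := ⌊z⌋₊
  have hk1 : (k : ℝ) ≤ z := Nat.floor_le (by linarith)
  have hk2 : z < k + 1 := Nat.lt_floor_add_one _
  have hk0 : (0 : ℝ) < k := by linarith
  have : NeZero k := ⟨by rintro h; simp [h] at hk0⟩
  refine ⟨{X | ∃ q ∈ (Finset.univ : Finset (Fin 2 → Fin k)), ∀ i, X i ∉ gridCell k q},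
    (pointsLaw_exists_empty_cell_le n k _).trans (ENNReal.ofReal_le_ofReal ?_), ?_⟩
  · have hkz : (k : ℝ) ^ 2 ≤ n / (2 * Real.log n) := hz2 ▸ pow_le_pow_left₀ hk0.le hk1 2
    have hexp : Real.exp (-(n / (k : ℝ) ^ 2)) ≤ 1 / (n : ℝ) ^ 2 := by
      have h2 : 2 * Real.log n ≤ n / (k : ℝ) ^ 2 := by
        rw [le_div_iff₀ (by positivity)] at hkz ⊢
        linarith
      calc Real.exp (-(n / (k : ℝ) ^ 2)) ≤ Real.exp (-(2 * Real.log n)) := by gcongr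
        _ = 1 / (n : ℝ) ^ 2 := by
          rw [Real.exp_neg, mul_comm, Real.exp_mul, Real.exp_log hn', one_div]
          norm_cast
    have hkn : (k : ℝ) ^ 2 ≤ n := hkz.trans (div_le_self hn'.le (by linarith))
    calc _ = (k : ℝ) ^ 2 * Real.exp (-(n / (k : ℝ) ^ 2)) := by simp
      _ ≤ n * (1 / (n : ℝ) ^ 2) := by gcongr
      _ = _ := by field_simp
  · intro X hX y hy
    have hX' : ∃ i, X i ∈ gridCell k (cellIndex k y) := by
      by_contra! h
      exact hX ⟨_, Finset.mem_univ _, h⟩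
    obtain ⟨i, hi⟩ := hX'
    refine ⟨i, (dist_le_of_mem_gridCell (mem_gridCell_cellIndex hy) hi).trans ?_⟩
    have hd : 0 ≤ denseScale n := by unfold denseScale; positivity
    rw [div_le_iff₀ hk0]
    refine Real.sqrt_le_iff.2 ⟨by positivity, ?_⟩
    have h4 : (z / 2) ^ 2 ≤ (k : ℝ) ^ 2 := pow_le_pow_left₀ (by linarith) (by linarith) 2
    rw [mul_pow, denseScale, mul_pow, Real.sq_sqrt (by positivity)]
    have e : 4 ^ 2 * (Real.log n / n) * (z / 2) ^ 2 = 2 := by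
      rw [div_pow, hz2]
      field_simp
      norm_num
    calc (2 : ℝ) = 4 ^ 2 * (Real.log n / n) * (z / 2) ^ 2 := e.symm
      _ ≤ _ := by gcongr

/-- For a bounded number of points of the square that are fixed in advance, nodes nearby are found
already at the scale `w / √n` with `w → ∞`; only the whole square needs the logarithm. -/
lemma exists_bad_not_near {n : ℕ} (hn : 0 < n) {w : ℝ} (hw : 0 < w) (hwn : w ≤ √(n : ℝ))
    {C : Finset Plane} (hC : ∀ c ∈ C, c ∈ unitSquare) : ∃ B : Set (Fin n → Plane),
    pointsLaw n B ≤ ENNReal.ofReal (C.card * Real.exp (-(w ^ 2 / 8))) ∧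
    ∀ X : Fin n → Plane, X ∉ B → ∀ c ∈ C, ∃ i, dist c (X i) ≤ w / √(n : ℝ) := by
  classical
  have hn' : (0 : ℝ) < n := by exact_mod_cast hn
  have hs : 0 < √(n : ℝ) := Real.sqrt_pos.2 hn'
  have h2 : √2 ^ 2 = (2 : ℝ) := Real.sq_sqrt (by norm_num)
  have h20 : (1 : ℝ) ≤ √2 := Real.one_le_sqrt.2 (by norm_num)
  set z := √2 * √(n : ℝ) / w
  have hz : 1 ≤ z := by
    rw [le_div_iff₀ hw]
    nlinarith
  set k := ⌈z⌉₊
  have hk1 : z ≤ k := Nat.le_ceil _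
  have hk2 : (k : ℝ) < z + 1 := Nat.ceil_lt_add_one (by linarith)
  have hk0 : (0 : ℝ) < k := by linarith
  have : NeZero k := ⟨by rintro h; simp [h] at hk0⟩
  refine ⟨{X | ∃ q ∈ C.image (cellIndex k), ∀ i, X i ∉ gridCell k q},
    (pointsLaw_exists_empty_cell_le n k _).trans (ENNReal.ofReal_le_ofReal ?_), ?_⟩
  · have hcard : ((C.image (cellIndex k)).card : ℝ) ≤ C.card := by
      exact_mod_cast Finset.card_image_le
    have hkz : (k : ℝ) ^ 2 ≤ 8 * n / w ^ 2 := by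
      calc (k : ℝ) ^ 2 ≤ (2 * z) ^ 2 := pow_le_pow_left₀ hk0.le (by linarith) 2
        _ = _ := by
          simp only [z]
          rw [mul_pow, div_pow, mul_pow, h2, Real.sq_sqrt hn'.le]
          ring
    have hle : w ^ 2 / 8 ≤ n / (k : ℝ) ^ 2 := by
      rw [le_div_iff₀ (by positivity)] at hkz ⊢
      linarith
    gcongr
  · intro X hX c hc
    have hX' : ∃ i, X i ∈ gridCell k (cellIndex k c) := by
      by_contra! h
      exact hX ⟨_, Finset.mem_image_of_mem _ hc, h⟩
    obtain ⟨i, hi⟩ := hX'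
    refine ⟨i, (dist_le_of_mem_gridCell (mem_gridCell_cellIndex (hC c hc)) hi).trans ?_⟩
    rw [div_le_div_iff₀ hk0 hs]
    rw [div_le_iff₀ hw] at hk1
    linarith

/-- If the cells are at least as wide as `r` and there are at most `n` of them, the domination
number is of the order of the number of cells. -/
lemma exists_bad_few_cells {n k : ℕ} (hk : 1 ≤ k) (hkn : k ^ 2 ≤ n) {r : ℝ} (hr : 0 ≤ r)
    (hrk : r ≤ 1 / k) : ∃ B : Set (Fin n → Plane), pointsLaw n B ≤ ENNReal.ofReal ((1 / 2) ^ n) ∧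
    ∀ X : Fin n → Plane, (∀ i, X i ∈ unitSquare) → X ∉ B →
      (k : ℝ) ^ 2 ≤ 36 * dominationNumber (geometricGraph X r) := by
  classical
  have : NeZero k := ⟨by omega⟩
  refine ⟨_, pointsLaw_few_cells_le hk hkn, fun X hX hXB => ?_⟩
  have h1 := card_image_cellIndex_le hr hX hrk
  have h2 : k ^ 2 < 4 * (Finset.univ.image fun i => cellIndex k (X i)).card := by
    by_contra! h
    exact hXB ⟨_, h, fun i => ⟨_, Finset.mem_image_of_mem _ (Finset.mem_univ i),
      mem_gridCell_cellIndex (hX i)⟩⟩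
  have h3 : k ^ 2 ≤ 36 * dominationNumber (geometricGraph X r) := by omega
  exact_mod_cast h3

/-! ### The four regimes -/

lemma squareCoveringNumber_ne_top {x : ℝ} (hx : 0 < x) : squareCoveringNumber x ≠ ⊤ := by
  obtain ⟨C, hC, -⟩ := exists_hexagonal_cover hx
  exact ne_top_of_le_ne_top (ENat.natCast_ne_top _) (squareCoveringNumber_le_card hC)

lemma denseScale_nonneg (n : ℕ) : 0 ≤ denseScale n := by unfold denseScale; positivity

lemma tendsto_ofReal_one_div_natCast :
    Tendsto (fun n : ℕ => ENNReal.ofReal (1 / (n : ℝ))) atTop (𝓝 0) := by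
  rw [← ENNReal.ofReal_zero]
  exact ENNReal.tendsto_ofReal tendsto_one_div_atTop_nhds_zero_nat

lemma tendsto_ofReal_half_pow :
    Tendsto (fun n : ℕ => ENNReal.ofReal ((1 / 2) ^ n)) atTop (𝓝 0) := by
  rw [← ENNReal.ofReal_zero]
  exact ENNReal.tendsto_ofReal
    (tendsto_pow_atTop_nhds_zero_of_lt_one (by norm_num) (by norm_num))

/-- For `r` bounded away from zero an optimal covering has boundedly many discs, so that the
nodes need only be dense at the scale `ω / √n` near the centres of these discs. -/
lemma aas_constant_radius {ω r : ℕ → ℝ} (hω : Tendsto ω atTop atTop) (hr : ∀ n, 0 ≤ r n)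
    {κ : ℝ} (hκ : 0 < κ) (hrκ : ∀ᶠ n in atTop, κ ≤ r n) :
    AAS fun n => {X |
      squareCoveringNumber (r n + √(ω n * Real.log n / n)) ≤
        (dominationNumber (geometricGraph X (r n)) : ℕ∞) ∧
      (dominationNumber (geometricGraph X (r n)) : ℕ∞) ≤
        squareCoveringNumber (r n - ω n / √(n : ℝ))} := by
  -- Replacing `ω` by a smaller function `w` strengthens the upper bound and keeps the radius of
  -- the discs bounded away from zero.
  set w : ℕ → ℝ := fun n => min (ω n) √√(n : ℝ)
  have hu : Tendsto (fun n : ℕ => √√(n : ℝ)) atTop atTop :=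
    Real.tendsto_sqrt_atTop.comp (Real.tendsto_sqrt_atTop.comp tendsto_natCast_atTop_atTop)
  have hw : Tendsto w atTop atTop := tendsto_atTop.2 fun b => by
    filter_upwards [hω.eventually_ge_atTop b, hu.eventually_ge_atTop b] with n h1 h2
    exact le_min h1 h2
  obtain ⟨K, hK⟩ : ∃ K : ℕ, (K : ℕ∞) = squareCoveringNumber (κ / 2) :=
    ENat.ne_top_iff_exists.1 (squareCoveringNumber_ne_top (by positivity))
  have hb : Tendsto (fun n : ℕ => ENNReal.ofReal (1 / (n : ℝ)) +
      ENNReal.ofReal (K * Real.exp (-(w n ^ 2 / 8)))) atTop (𝓝 0) := by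
    rw [← add_zero (0 : ℝ≥0∞)]
    refine tendsto_ofReal_one_div_natCast.add ?_
    rw [← ENNReal.ofReal_zero]
    refine ENNReal.tendsto_ofReal ?_
    rw [← mul_zero (K : ℝ)]
    refine tendsto_const_nhds.mul (Real.tendsto_exp_neg_atTop_nhds_zero.comp ?_)
    exact ((tendsto_pow_atTop two_ne_zero).comp hw).atTop_div_const (by norm_num)
  refine AAS.of_bad hb ?_
  filter_upwards [exists_bad_not_dense, hrκ, hω.eventually_ge_atTop 16, hw.eventually_gt_atTop 0,
    eventually_gt_atTop 0, hu.eventually_ge_atTop (max 1 (2 / κ))]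
    with n ⟨B₁, hB₁, hX₁⟩ hrn hωn hwn hn hun
  have hn' : (0 : ℝ) < n := by exact_mod_cast hn
  have hs : 0 < √(n : ℝ) := Real.sqrt_pos.2 hn'
  have hss : √√(n : ℝ) ^ 2 = √(n : ℝ) := Real.sq_sqrt hs.le
  have hu1 : 1 ≤ √√(n : ℝ) := (le_max_left _ _).trans hun
  have hu2 : 2 / κ ≤ √√(n : ℝ) := (le_max_right _ _).trans hun
  have hwu : w n ≤ √√(n : ℝ) := min_le_right _ _
  have hδ : w n / √(n : ℝ) ≤ κ / 2 := by
    rw [div_le_iff₀ hs]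
    rw [div_le_iff₀ hκ] at hu2
    nlinarith
  have hx : κ / 2 ≤ r n - w n / √(n : ℝ) := by linarith
  obtain ⟨C, hC, hcard⟩ := exists_cover_card_eq (x := r n - w n / √(n : ℝ)) (by linarith)
    (squareCoveringNumber_ne_top (by linarith))
  have hCK : C.card ≤ K := by
    have := squareCoveringNumber_antitone hx
    rw [← hcard, ← hK] at this
    exact_mod_cast this
  classical
  obtain ⟨B₂, hB₂, hX₂⟩ := exists_bad_not_near hn hwn (hwu.trans (by nlinarith))
    (C := C.image clampSquare) (by
      intro c hc
      obtain ⟨p, -, rfl⟩ := Finset.mem_image.1 hc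
      exact clampSquare_mem p)
  refine ⟨B₁ ∪ B₂, (measure_union_le _ _).trans (add_le_add hB₁ (hB₂.trans ?_)), ?_⟩
  · refine ENNReal.ofReal_le_ofReal ?_
    have : ((C.image clampSquare).card : ℝ) ≤ K := by
      exact_mod_cast Finset.card_image_le.trans hCK
    gcongr
  · intro X hX hXB
    simp only [Set.mem_union, not_or] at hXB
    refine ⟨?_, ?_⟩
    · refine le_trans (squareCoveringNumber_antitone ?_)
        (squareCoveringNumber_le_dominationNumber (hr n) (hX₁ X hXB.1))
      have : denseScale n ≤ √(ω n * Real.log n / n) := by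
        refine Real.le_sqrt_of_sq_le ?_
        have hl : 0 ≤ Real.log n / (n : ℝ) := div_nonneg (Real.log_natCast_nonneg n) hn'.le
        rw [denseScale, mul_pow, Real.sq_sqrt hl, mul_div_assoc]
        gcongr
        linarith
      linarith
    · have h1 : dominationNumber (geometricGraph X (r n)) ≤ C.card :=
        dominationNumber_le_card_cover hX (by linarith) hC
          fun c hc => hX₂ X hXB.2 _ (Finset.mem_image_of_mem _ hc)
      calc (dominationNumber (geometricGraph X (r n)) : ℕ∞) ≤ C.card := by exact_mod_cast h1
        _ = squareCoveringNumber (r n - w n / √(n : ℝ)) := hcard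
        _ ≤ _ := by
          refine squareCoveringNumber_antitone ?_
          have : w n ≤ ω n := min_le_left _ _
          gcongr

lemma coveringConstant_div_pi : coveringConstant / Real.pi = 2 / (3 * √3) := by
  have h3 : √3 ^ 2 = 3 := Real.sq_sqrt (by norm_num)
  have h30 : 0 < √3 := Real.sqrt_pos.2 (by norm_num)
  have := Real.pi_pos
  rw [coveringConstant]
  field_simp
  linarith

/-- If the nodes are dense at a scale `δ` that is negligible with respect to `r`, the hexagonal
covering and the lower bound for the density of coverings determine the domination number. -/
lemma aas_small_radius {r : ℕ → ℝ} (hr0 : ∀ᶠ n in atTop, 0 < r n) (hr : Tendsto r atTop (𝓝 0))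
    (hq : Tendsto (fun n => denseScale n / r n) atTop (𝓝 0)) {ε : ℝ} (hε : 0 < ε) :
    AAS fun n => {X |
      |(dominationNumber (geometricGraph X (r n)) : ℝ) -
          coveringConstant / Real.pi * r n ^ (-2 : ℤ)| ≤ ε * r n ^ (-2 : ℤ)} := by
  have h3 : 0 < √3 := Real.sqrt_pos.2 (by norm_num)
  set q : ℕ → ℝ := fun n => denseScale n / r n
  have hlow : Tendsto (fun n => 2 / (3 * √3) * (1 - 2 * (r n * (1 + 2 * q n))) ^ 2 /
      (1 + 2 * q n) ^ 2) atTop (𝓝 (2 / (3 * √3))) := by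
    have h1 : Tendsto (fun n => 1 + 2 * q n) atTop (𝓝 (1 + 2 * 0)) :=
      (hq.const_mul 2).const_add 1
    have h2 := (((((hr.mul h1).const_mul 2).const_sub 1).pow 2).const_mul (2 / (3 * √3))).div
      (h1.pow 2) (by norm_num)
    have e : 2 / (3 * √3) * (1 - 2 * (0 * (1 + 2 * 0))) ^ 2 / (1 + 2 * 0) ^ 2 = 2 / (3 * √3) := by
      norm_num
    rwa [e] at h2
  have hupp : Tendsto (fun n => (2 / (3 * (1 - q n)) + 2 * r n) *
      (1 / (√3 * (1 - q n)) + 2 * r n)) atTop (𝓝 (2 / (3 * √3))) := by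
    have h1 : Tendsto (fun n => 1 - q n) atTop (𝓝 (1 - 0)) := hq.const_sub 1
    have h2 := ((tendsto_const_nhds (x := (2 : ℝ))).div (h1.const_mul 3) (by norm_num)).add
      (hr.const_mul 2)
    have h4 := ((tendsto_const_nhds (x := (1 : ℝ))).div (h1.const_mul √3) (by simp)).add
      (hr.const_mul 2)
    have h5 := h2.mul h4
    have e : (2 / (3 * (1 - 0)) + 2 * 0) * (1 / (√3 * (1 - 0)) + 2 * 0) = 2 / (3 * √3) := by
      field_simp
      ring
    rwa [e] at h5
  have hhalf : Tendsto (fun n => r n * (1 + 2 * q n)) atTop (𝓝 0) := by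
    have := hr.mul ((hq.const_mul 2).const_add 1)
    simpa using this
  refine AAS.of_bad tendsto_ofReal_one_div_natCast ?_
  have hlog1 : ∀ᶠ n : ℕ in atTop, 1 ≤ Real.log (n : ℝ) :=
    (Real.tendsto_log_atTop.comp tendsto_natCast_atTop_atTop).eventually_ge_atTop 1
  filter_upwards [exists_bad_not_dense, hr0, hlow.eventually (lt_mem_nhds (sub_lt_self _ hε)),
    hupp.eventually (gt_mem_nhds (lt_add_of_pos_right _ hε)),
    hq.eventually (gt_mem_nhds (show (0 : ℝ) < 1 by norm_num)),
    hhalf.eventually (gt_mem_nhds (show (0 : ℝ) < 1 / 2 by norm_num)), hlog1,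
    eventually_gt_atTop 0] with n ⟨B, hB, hXd⟩ hrn hl hu hq1 hh hlogn hn
  have hn' : (0 : ℝ) < n := by exact_mod_cast hn
  refine ⟨B, hB, fun X hX hXB => ?_⟩
  have hdense := hXd X hXB
  set δ := denseScale n
  have hδ0 : 0 < δ := by
    simp only [δ, denseScale]
    have : 0 < Real.log n / (n : ℝ) := div_pos (by linarith) hn'
    positivity
  have hqr : q n * r n = δ := div_mul_cancel₀ _ hrn.ne'
  set γ := dominationNumber (geometricGraph X (r n))
  have hlower : (1 - 2 * (r n + 2 * δ)) ^ 2 ≤ γ * (3 * √3 / 2 * (r n + 2 * δ) ^ 2) := by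
    have h1 := squareCoveringNumber_le_dominationNumber hrn.le hdense
    obtain ⟨C, hC, hcard⟩ := exists_cover_card_eq (x := r n + δ) (by positivity)
      (ne_top_of_le_ne_top (ENat.natCast_ne_top _) h1)
    rw [← hcard] at h1
    have h2 : (C.card : ℝ) ≤ γ := by exact_mod_cast h1
    refine (covering_lower_bound (R := r n + δ) (R' := r n + 2 * δ) (by positivity) (by linarith)
      ?_ hC).trans (by gcongr)
    have : r n * (1 + 2 * q n) = r n + 2 * δ := by rw [← hqr]; ring
    linarith
  have hδr : δ < r n := by
    rw [← hqr]
    nlinarith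
  have hupper : (γ : ℝ) ≤ (2 / (3 * (r n - δ)) + 2) * (1 / (√3 * (r n - δ)) + 2) := by
    obtain ⟨C, hC, hcard⟩ := exists_hexagonal_cover (x := r n - δ) (by linarith)
    have h1 := dominationNumber_le_squareCoveringNumber hX hδr.le hdense
    have h2 := h1.trans (squareCoveringNumber_le_card hC)
    have h4 : (γ : ℝ) ≤ C.card := by exact_mod_cast h2
    exact h4.trans hcard
  have hr2 : 0 < r n ^ 2 := by positivity
  have hq0 : 0 ≤ q n := div_nonneg hδ0.le hrn.le
  have hlower' : 2 / (3 * √3) - ε ≤ γ * r n ^ 2 := by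
    refine hl.le.trans ?_
    rw [div_le_iff₀ (by positivity)]
    have e1 : r n + 2 * δ = r n * (1 + 2 * q n) := by rw [← hqr]; ring
    rw [e1] at hlower
    calc _ ≤ 2 / (3 * √3) * (γ * (3 * √3 / 2 * (r n * (1 + 2 * q n)) ^ 2)) := by gcongr
      _ = _ := by field_simp
  have hupper' : γ * r n ^ 2 ≤ 2 / (3 * √3) + ε := by
    refine le_trans ?_ hu.le
    have e1 : r n - δ = r n * (1 - q n) := by rw [← hqr]; ring
    rw [e1] at hupper
    have hq1' : 0 < 1 - q n := by linarith
    calc _ ≤ (2 / (3 * (r n * (1 - q n))) + 2) * (1 / (√3 * (r n * (1 - q n))) + 2) *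
          r n ^ 2 := by gcongr
      _ = _ := by field_simp
  have hz : r n ^ (-2 : ℤ) = (r n ^ 2)⁻¹ := by rw [zpow_neg]; norm_cast
  change |(γ : ℝ) - coveringConstant / Real.pi * r n ^ (-2 : ℤ)| ≤ ε * r n ^ (-2 : ℤ)
  rw [hz, coveringConstant_div_pi, ← div_eq_mul_inv, ← div_eq_mul_inv,
    show (γ : ℝ) - 2 / (3 * √3) / r n ^ 2 = (γ * r n ^ 2 - 2 / (3 * √3)) / r n ^ 2 by
      field_simp, abs_div, abs_of_pos hr2]
  gcongr
  rw [abs_le]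
  constructor <;> linarith

lemma one_le_dominationNumber {n : ℕ} (hn : 0 < n) {X : Fin n → Plane} {r : ℝ} (hr : 0 ≤ r) :
    1 ≤ dominationNumber (geometricGraph X r) := by
  obtain ⟨D, hD, hcard⟩ := exists_isDominating_card_eq (geometricGraph X r)
  obtain ⟨u, hu, -⟩ := exists_dist_le_of_isDominating hr hD ⟨0, hn⟩
  rw [← hcard]
  exact Finset.card_pos.2 ⟨u, hu⟩

lemma aas_intermediate_radius {r : ℕ → ℝ} (hr : ∀ᶠ n : ℕ in atTop, 1 / √(n : ℝ) ≤ r n) {K : ℝ}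
    (hK : ∀ᶠ n in atTop, r n ≤ K) :
    AAS fun n => {X |
      1 / 144 * r n ^ (-2 : ℤ) ≤ (dominationNumber (geometricGraph X (r n)) : ℝ) ∧
      (dominationNumber (geometricGraph X (r n)) : ℝ) ≤ (√2 + K) ^ 2 * r n ^ (-2 : ℤ)} := by
  refine AAS.of_bad tendsto_ofReal_half_pow ?_
  filter_upwards [hr, hK, eventually_gt_atTop 0] with n hrn hKn hn
  have hn' : (0 : ℝ) < n := by exact_mod_cast hn
  have hs : 0 < √(n : ℝ) := Real.sqrt_pos.2 hn'
  have hr0 : 0 < r n := lt_of_lt_of_le (by positivity) hrn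
  have h2 : 0 < √2 := Real.sqrt_pos.2 (by norm_num)
  have hz : r n ^ (-2 : ℤ) = (1 / r n) ^ 2 := by
    rw [zpow_neg, one_div, inv_pow]; norm_cast
  have hupper : ∀ X : Fin n → Plane, (∀ i, X i ∈ unitSquare) →
      (dominationNumber (geometricGraph X (r n)) : ℝ) ≤ (√2 + K) ^ 2 * r n ^ (-2 : ℤ) := by
    intro X hX
    set k := ⌈√2 / r n⌉₊
    have hk1 : √2 / r n ≤ k := Nat.le_ceil _
    have hk2 : (k : ℝ) < √2 / r n + 1 := Nat.ceil_lt_add_one (by positivity)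
    have hk0 : (0 : ℝ) < k := lt_of_lt_of_le (by positivity) hk1
    have : NeZero k := ⟨by rintro h; simp [h] at hk0⟩
    have h := dominationNumber_le_sq (k := k) hX (r := r n) (by
      rw [div_le_iff₀ hk0]
      rw [div_le_iff₀ hr0] at hk1
      linarith)
    calc (dominationNumber (geometricGraph X (r n)) : ℝ) ≤ (k : ℝ) ^ 2 := by exact_mod_cast h
      _ ≤ (√2 / r n + 1) ^ 2 := by gcongr
      _ = ((√2 + r n) * (1 / r n)) ^ 2 := by field_simp
      _ ≤ ((√2 + K) * (1 / r n)) ^ 2 := by gcongr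
      _ = _ := by rw [hz, mul_pow]
  rcases le_or_gt (r n) 1 with h1 | h1
  · set k := ⌊1 / r n⌋₊
    have hone : 1 ≤ 1 / r n := by rw [le_div_iff₀ hr0]; linarith
    have hk : 1 ≤ k := Nat.le_floor (by simpa using hone)
    have hk' : (1 : ℝ) ≤ k := by exact_mod_cast hk
    have hk1 : (k : ℝ) ≤ 1 / r n := Nat.floor_le (by positivity)
    have hk2 : 1 / r n < k + 1 := Nat.lt_floor_add_one _
    have hrs : 1 / r n ≤ √(n : ℝ) := by
      rw [div_le_iff₀ hs] at hrn
      rw [div_le_iff₀ hr0]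
      linarith
    have hkn : k ^ 2 ≤ n := by
      have : (k : ℝ) ^ 2 ≤ (n : ℝ) := by
        calc (k : ℝ) ^ 2 ≤ √(n : ℝ) ^ 2 := by gcongr; linarith
          _ = (n : ℝ) := Real.sq_sqrt hn'.le
      exact_mod_cast this
    obtain ⟨B, hB, hX⟩ := exists_bad_few_cells hk hkn hr0.le (by
      rw [le_div_iff₀ (by linarith)]
      rw [le_div_iff₀ hr0] at hk1
      linarith)
    refine ⟨B, hB, fun X hXS hXB => ⟨?_, hupper X hXS⟩⟩
    have h3 := hX X hXS hXB
    have h4 : (1 / r n) ^ 2 ≤ (2 * k) ^ 2 := by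
      have : 1 / r n ≤ 2 * k := by linarith
      gcongr
    rw [hz]
    linarith
  · refine ⟨∅, by simp, fun X hXS _ => ⟨?_, hupper X hXS⟩⟩
    have h3 : (1 : ℝ) ≤ dominationNumber (geometricGraph X (r n)) := by
      exact_mod_cast one_le_dominationNumber hn hr0.le
    have h4 : (1 / r n) ^ 2 ≤ 1 := by
      refine pow_le_one₀ (by positivity) ?_
      rw [div_le_iff₀ hr0]
      linarith
    rw [hz]
    linarith

lemma aas_tiny_radius {r : ℕ → ℝ} (hr0 : ∀ n, 0 ≤ r n)
    (hr : ∀ᶠ n : ℕ in atTop, r n < 1 / √(n : ℝ)) :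
    AAS fun n => {X |
      1 / 144 * (n : ℝ) ≤ (dominationNumber (geometricGraph X (r n)) : ℝ) ∧
      (dominationNumber (geometricGraph X (r n)) : ℝ) ≤ 1 * (n : ℝ)} := by
  refine AAS.of_bad tendsto_ofReal_half_pow ?_
  filter_upwards [hr, eventually_gt_atTop 0] with n hrn hn
  have hn1 : (1 : ℝ) ≤ n := by exact_mod_cast hn
  have hs : 1 ≤ √(n : ℝ) := Real.one_le_sqrt.2 hn1
  have hss : √(n : ℝ) ^ 2 = n := Real.sq_sqrt (by linarith)
  set k := ⌊√(n : ℝ)⌋₊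
  have hk : 1 ≤ k := Nat.le_floor (by simpa using hs)
  have hk' : (1 : ℝ) ≤ k := by exact_mod_cast hk
  have hk1 : (k : ℝ) ≤ √(n : ℝ) := Nat.floor_le (by positivity)
  have hk2 : √(n : ℝ) < k + 1 := Nat.lt_floor_add_one _
  have hkn : k ^ 2 ≤ n := by
    have : (k : ℝ) ^ 2 ≤ n := hss ▸ pow_le_pow_left₀ (by linarith) hk1 2
    exact_mod_cast this
  obtain ⟨B, hB, hX⟩ := exists_bad_few_cells hk hkn (hr0 n) (hrn.le.trans (by gcongr))
  refine ⟨B, hB, fun X hXS hXB => ⟨?_, ?_⟩⟩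
  · have h3 := hX X hXS hXB
    have h4 : (n : ℝ) ≤ (2 * k) ^ 2 := hss ▸ pow_le_pow_left₀ (by linarith) (by linarith) 2
    linarith
  · rw [one_mul]
    exact_mod_cast dominationNumber_le_card _

end RandomGeometricGraph

theorem theorem2 (ω r : ℕ → ℝ) (hω : Tendsto ω atTop atTop) (hr : ∀ n, 0 ≤ r n) :
    -- (a)
    ((r =Θ[atTop] fun _ => (1 : ℝ)) →
      (∃ c : ℝ, 0 < c ∧ ∀ᶠ n : ℕ in atTop,
        ENNReal.ofReal c ≤ (squareCoveringNumber (r n + √(ω n * Real.log n / n)) : ℝ≥0∞)) ∧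
      AAS fun n => {X |
        squareCoveringNumber (r n + √(ω n * Real.log n / n)) ≤
          (dominationNumber (geometricGraph X (r n)) : ℕ∞) ∧
        (dominationNumber (geometricGraph X (r n)) : ℕ∞) ≤
          squareCoveringNumber (r n - ω n / √(n : ℝ))}) ∧
    -- (b)
    ((∀ᶠ n : ℕ in atTop, ω n * √(Real.log n / n) ≤ r n) → Tendsto r atTop (𝓝 0) →
      ∀ ε : ℝ, 0 < ε → AAS fun n => {X |
        |(dominationNumber (geometricGraph X (r n)) : ℝ) -
            coveringConstant / Real.pi * r n ^ (-2 : ℤ)| ≤ ε * r n ^ (-2 : ℤ)}) ∧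
    -- (c)
    ((∀ᶠ n : ℕ in atTop, 1 / √(n : ℝ) ≤ r n ∧ r n < ω n * √(Real.log n / n)) →
      (r =O[atTop] fun _ => (1 : ℝ)) →
      ∃ c₁ c₂ : ℝ, 0 < c₁ ∧ 0 < c₂ ∧ AAS fun n => {X |
        c₁ * r n ^ (-2 : ℤ) ≤ (dominationNumber (geometricGraph X (r n)) : ℝ) ∧
        (dominationNumber (geometricGraph X (r n)) : ℝ) ≤ c₂ * r n ^ (-2 : ℤ)}) ∧
    -- (d)
    ((∀ᶠ n : ℕ in atTop, r n < 1 / √(n : ℝ)) →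
      ∃ c₁ c₂ : ℝ, 0 < c₁ ∧ 0 < c₂ ∧ AAS fun n => {X |
        c₁ * (n : ℝ) ≤ (dominationNumber (geometricGraph X (r n)) : ℝ) ∧
        (dominationNumber (geometricGraph X (r n)) : ℝ) ≤ c₂ * (n : ℝ)}) := by

  refine ⟨fun hΘ => ⟨⟨1, one_pos, Eventually.of_forall fun n => ?_⟩, ?_⟩, ?_, ?_, ?_⟩
  · rw [ENNReal.ofReal_one]
    exact_mod_cast one_le_squareCoveringNumber _
  · obtain ⟨K, hK, hbound⟩ := hΘ.isBigO_symm.exists_pos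
    refine aas_constant_radius hω hr (κ := 1 / K) (by positivity) ?_
    filter_upwards [hbound.bound] with n hn
    rw [norm_one, Real.norm_of_nonneg (hr n)] at hn
    rw [div_le_iff₀ hK]
    linarith
  · intro hlow hr0 ε hε
    have hlog1 : ∀ᶠ n : ℕ in atTop, 1 ≤ Real.log (n : ℝ) :=
      (Real.tendsto_log_atTop.comp tendsto_natCast_atTop_atTop).eventually_ge_atTop 1
    have hpos : ∀ᶠ n : ℕ in atTop, 0 < √(Real.log n / n) := by
      filter_upwards [hlog1, eventually_gt_atTop 0] with n h1 hn
      have hn' : (0 : ℝ) < n := by exact_mod_cast hn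
      exact Real.sqrt_pos.2 (div_pos (by linarith) hn')
    have hr' : ∀ᶠ n in atTop, 0 < r n := by
      filter_upwards [hlow, hpos, hω.eventually_gt_atTop 0] with n h1 h2 h3
      exact lt_of_lt_of_le (mul_pos h3 h2) h1
    refine aas_small_radius hr' hr0 ?_ hε
    refine squeeze_zero' (Eventually.of_forall fun n => div_nonneg (denseScale_nonneg n) (hr n)) ?_
      (hω.const_div_atTop 4)
    filter_upwards [hlow, hr', hω.eventually_gt_atTop 0] with n h1 h2 h3
    rw [div_le_div_iff₀ h2 h3, denseScale]
    linarith
  · intro hlow hO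
    obtain ⟨K, hK, hbound⟩ := hO.exists_pos
    refine ⟨1 / 144, (√2 + K) ^ 2, by norm_num, by positivity,
      aas_intermediate_radius (hlow.mono fun n hn => hn.1) ?_⟩
    filter_upwards [hbound.bound] with n hn
    rwa [norm_one, mul_one, Real.norm_of_nonneg (hr n)] at hn
  · intro hsmall
    exact ⟨1 / 144, 1, by norm_num, one_pos, aas_tiny_radius hr hsmall⟩
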